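/- Let $\mathbf k$ be a field and let $Z$ be a set with a well-order. Let $\mathfrak S(Z)$ be the free operated semigroup on $Z$: its elements are the nonempty words $u$ whose letters are elements of $Z$ or symbols $\lfloor v\rfloor$ with $v\in\mathfrak S(Z)$, with concatenation as product and $u\mapsto\lfloor u\rfloor$ as operator. The length of $u$ over the alphabet $Z\sqcup\lfloor\mathfrak S(Z)\rfloor$ is its breadth $|u|$. Let $\mathfrak S^\star(Z)$ be the set of elements of $\mathfrak S(Z\sqcup\{\star\})$ in which $\star$ occurs exactly once; for $q\in\mathfrak S^\star(Z)$, $q|_u$ is obtained by replacing $\star$ by $u$, and $q|_s$ is defined for $s\in\mathbf k\mathfrak S(Z)$ by linearity. A monomial order on $\mathfrak S(Z)$ is a well-order $\le$ such that $u<v$ implies $q|_u<q|_v$ for all $q\in\mathfrak S^\star(Z)$; $\bar f$ denotes the leading monomial of $f\ne0$. A subset $G\subseteq\mathbf k\mathfrak S(Z)$ is an operated GS (Gröbner–Shirshov) basis with respect to a monomial order $\le$ if for all nonzero $f,g\in G$, divided by their leading coefficients, (i) whenever $w=\bar f u=v\bar g$ with $u,v\in\mathfrak S(Z)$ and $\max\{|\bar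 f|,|\bar g|\}<|w|<|\bar f|+|\bar g|$, the element $fu-vg$ is trivial modulo $(G,w)$, and (ii) whenever $w=\bar f=q|_{\bar g}$ with $q\in\mathfrak S^\star(Z)$, the element $f-q|_g$ is trivial modulo $(G,w)$. Here $h$ is trivial modulo $(G,w)$ if $h=\sum_i c_iq_i|_{s_i}$ (a finite sum) with $c_i\in\mathbf k$, $q_i\in\mathfrak S^\star(Z)$, $0\neq s_i\in G$ and $q_i|_{\bar s_i}<w$. An element $\phi(x,y)\in\mathbf k\mathfrak S(\{x,y\})$ is GS on $\mathbf k\mathfrak S(Z)$ with respect to a monomial order $\le$ if $\{\phi(u,v): u,v\in\mathfrak S(Z)\}$ is an operated GS basis with respect to $\le$. Orders. For $u\in\mathfrak S(Z)$ let $\deg_P(u)$ be the number of brackets $\lfloor\ \rfloor$ in $u$, $\deg_Z(u)$ the number of occurrences of elements of $Z$ in $u$, and $\deg_G(u)$ (resp. $\deg_G'(u)$) the sum over all half brackets of $u$ of the number of occurrences of elements of $Z$ to the left (resp. to the right) of it. Write $u=u_0\lfloor u_1^*\rfloor u_1\cdots\lfloor u_r^*\rfloor u_r$ with $u_i$ (possibly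 empty) words in $Z$ and $u_i^*\in\mathfrak S(Z)$, and put $|u|_P=r$. Let $\le_{\mathrm{Dlex}}$ be the recursively defined degree lexicographic order on words over the alphabet $Z\sqcup\lfloor\mathfrak S(Z)\rfloor$: words are compared first by breadth, then lexicographically, where every element of $Z$ is smaller than every $\lfloor u\rfloor$, and $\lfloor u\rfloor<\lfloor v\rfloor$ iff $u<_{\mathrm{Dlex}}v$. Then * $\le_{\mathrm{dl}}$ compares successively $\deg_P$, $\deg_Z$, $\deg_G$ and $\le_{\mathrm{Dlex}}$; * $\le_{\mathrm{dl}'}$ compares successively $\deg_P$, $\deg_Z$, $\deg_G'$ and $\le_{\mathrm{Dlex}}$; * $\le_{\mathrm{db}}$ compares successively $\deg_P$, $|\cdot|_P$ and the tuples $(u_1^*,\dots,u_r^*,u_0,\dots,u_r)$ lexicographically, the $u_i^*$ being compared recursively by $\le_{\mathrm{db}}$ and the $u_i$ by the degree lexicographic order, with the empty word smallest. Theorem. The orders named below are monomial orders on $\mathfrak S(Z)$, and for all $\lambda,\mu,\nu\in\mathbf k$ the following elements of $\mathbf k\mathfrak S(\{x,y\})$ are GS on $\mathbf k\mathfrak S(Z)$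 with respect to the indicated order: * $(\mathcal N1'_a)$ $\lfloor x\rfloor\lfloor y\rfloor-\lambda(x\lfloor y\rfloor+\lfloor x\rfloor y)+\mu\lfloor xy\rfloor+\nu xy$ with $\lambda^2=\lambda\mu+\nu$, with respect to $\le_{\mathrm{db}}$; * $(\mathcal N1'_b)$ $x\lfloor y\rfloor-\lfloor xy\rfloor+\lfloor x\rfloor y-\lambda xy$, with respect to $\le_{\mathrm{dl}}$; * $(\mathcal N1'_c)=(\mathcal N2'_b)$ $\lfloor xy\rfloor-\lambda xy$, with respect to $\le_{\mathrm{db}}$; * $(\mathcal N2'_a)$ $\lfloor x\rfloor\lfloor y\rfloor-\lambda(x\lfloor y\rfloor+\lfloor x\rfloor y)+\mu\lfloor yx\rfloor+\lambda^2xy-\lambda\mu yx$, with respect to $\le_{\mathrm{db}}$; * $(\mathcal N3')$ $x\lfloor y\rfloor-\lfloor xy\rfloor$, with respect to $\le_{\mathrm{dl}}$; * $(\mathcal N4')$ $\lfloor x\rfloor y-\lfloor xy\rfloor$, with respect to $\le_{\mathrm{dl}'}$. -/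

import Mathlib

namespace OperatedGS

/-! ### The free operated semigroup -/

/-- The free operated semigroup `𝔖(Z)` on `Z`. An element is a nonempty word `a₁ ⋯ aₙ` whose letters
`aᵢ` lie in `Z ⊔ ⌊𝔖(Z)⌋`; the four constructors are the one-letter words `z` and `⌊u⌋` and the longer
words `z u` and `⌊u⌋ v`. -/
inductive OpWord (Z : Type*) : Type _
  | var (z : Z) : OpWord Z
  | br (u : OpWord Z) : OpWord Z
  | varMul (z : Z) (u : OpWord Z) : OpWord Z
  | brMul (u v : OpWord Z) : OpWord Z

namespace OpWord

variable {Z : Type*}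

/-- Concatenation. -/
def mul : OpWord Z → OpWord Z → OpWord Z
  | var z, w => varMul z w
  | br u, w => brMul u w
  | varMul z u, w => varMul z (mul u w)
  | brMul u v, w => brMul u (mul v w)

instance : Mul (OpWord Z) := ⟨mul⟩

@[simp] theorem var_mul (z : Z) (w : OpWord Z) : var z * w = varMul z w := rfl

@[simp] theorem br_mul (u w : OpWord Z) : br u * w = brMul u w := rfl

@[simp] theorem varMul_mul (z : Z) (u w : OpWord Z) : varMul z u * w = varMul z (u * w) := rfl

@[simp] theorem brMul_mul (u v w : OpWord Z) : brMul u v * w = brMul u (v * w) := rfl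

protected theorem mul_assoc (u v w : OpWord Z) : u * v * w = u * (v * w) := by
  induction u with
  | var z => rfl
  | br u _ => rfl
  | varMul z u ih => simp [ih]
  | brMul u u' _ ih => simp [ih]

instance : Semigroup (OpWord Z) where
  mul_assoc := OpWord.mul_assoc

/-- The morphism of operated semigroups `𝔖(Z) → 𝔖(W)` that sends each `z ∈ Z` to `σ z`. -/
def subst {W : Type*} (σ : Z → OpWord W) : OpWord Z → OpWord W
  | var z => σ z
  | br u => br (subst σ u)
  | varMul z u => σ z * subst σ u
  | brMul u v => br (subst σ u) * subst σ v

/-- The elements of `Z` that occur in a word, from left to right, with repetitions. -/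
def letters : OpWord Z → List Z
  | var z => [z]
  | br u => letters u
  | varMul z u => z :: letters u
  | brMul u v => letters u ++ letters v

/-- The breadth `|u|`: the number of letters of `u` over the alphabet `Z ⊔ ⌊𝔖(Z)⌋`. -/
def breadth : OpWord Z → ℕ
  | var _ => 1
  | br _ => 1
  | varMul _ u => breadth u + 1
  | brMul _ v => breadth v + 1

/-! ### Degrees -/

/-- The `P`-degree: the number of occurrences of `⌊ ⌋` in a word. -/
def degP : OpWord Z → ℕ
  | var _ => 0
  | br u => degP u + 1
  | varMul _ u => degP u
  | brMul u v => degP u + 1 + degP v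

/-- The `X`-degree: the number of elements of `Z` occurring in a word, with repetitions. -/
def degX (u : OpWord Z) : ℕ := u.letters.length

/-- The sum, over all half brackets of a word that is preceded by `n` further elements of `Z`,
of the number of elements of `Z` to the left of that half bracket. -/
def degGAux : ℕ → OpWord Z → ℕ
  | _, var _ => 0
  | n, br u => n + degGAux n u + (n + degX u)
  | n, varMul _ u => degGAux (n + 1) u
  | n, brMul u v => n + degGAux n u + (n + degX u) + degGAux (n + degX u) v

/-- The `G`-degree: each half bracket counts the elements of `Z` to its left. -/
def degG (u : OpWord Z) : ℕ := degGAux 0 u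

/-- The sum, over all half brackets of a word that is followed by `m` further elements of `Z`,
of the number of elements of `Z` to the right of that half bracket. -/
def degGAux' : ℕ → OpWord Z → ℕ
  | _, var _ => 0
  | m, br u => (degX u + m) + degGAux' m u + m
  | m, varMul _ u => degGAux' m u
  | m, brMul u v =>
      (degX u + (degX v + m)) + degGAux' (degX v + m) u + (degX v + m) + degGAux' m v

/-- The modified `G`-degree: each half bracket counts the elements of `Z` to its right. -/
def degG' (u : OpWord Z) : ℕ := degGAux' 0 u

/-! ### The orders (all of them are given by their strict parts) -/

/-- The strict lexicographic comparison of two words of equal breadth over the alphabet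
`Z ⊔ ⌊𝔖(Z)⌋`. In the alphabet every `z ∈ Z` is smaller than every `⌊u⌋`, elements of `Z` are compared
in `Z`, and `⌊u⌋ < ⌊v⌋` if `u` is smaller than `v` degree-lexicographically. -/
def LexLT [LT Z] : OpWord Z → OpWord Z → Prop
  | var z, var z' => z < z'
  | var _, br _ => True
  | br u, br v => breadth u < breadth v ∨ (breadth u = breadth v ∧ LexLT u v)
  | varMul z u, varMul z' v => z < z' ∨ (z = z' ∧ LexLT u v)
  | varMul _ _, brMul _ _ => True
  | brMul u u', brMul v v' =>
      (breadth u < breadth v ∨ (breadth u = breadth v ∧ LexLT u v)) ∨ (u = v ∧ LexLT u' v')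
  | _, _ => False

/-- `u <_Dlex v`: the recursive degree lexicographic order. -/
def DlexLT [LT Z] (u v : OpWord Z) : Prop :=
  breadth u < breadth v ∨ (breadth u = breadth v ∧ LexLT u v)

/-- `u <_dl v`: compare `deg_P`, then `deg_X`, then `deg_G`, then `Dlex`. -/
def DlLT [LT Z] (u v : OpWord Z) : Prop :=
  degP u < degP v ∨ (degP u = degP v ∧ (degX u < degX v ∨ (degX u = degX v ∧
    (degG u < degG v ∨ (degG u = degG v ∧ DlexLT u v)))))

/-- `u <_dl' v`: as `<_dl`, with the modified `G`-degree. -/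
def DlLT' [LT Z] (u v : OpWord Z) : Prop :=
  degP u < degP v ∨ (degP u = degP v ∧ (degX u < degX v ∨ (degX u = degX v ∧
    (degG' u < degG' v ∨ (degG' u = degG' v ∧ DlexLT u v)))))

/-- For `u = u₀⌊u₁*⌋u₁ ⋯ ⌊uᵣ*⌋uᵣ` with `uᵢ` in the free monoid on `Z`, the list `[u₁*, …, uᵣ*]`. -/
def stars : OpWord Z → List (OpWord Z)
  | var _ => []
  | br u => [u]
  | varMul _ u => stars u
  | brMul u v => u :: stars v

/-- For `u = u₀⌊u₁*⌋u₁ ⋯ ⌊uᵣ*⌋uᵣ` with `uᵢ` in the free monoid on `Z`, the list `[u₀, …, uᵣ]`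
(of length `r + 1`; elements of the free monoid are written as lists, `[]` being the empty word). -/
def gaps : OpWord Z → List (List Z)
  | var z => [[z]]
  | br _ => [[], []]
  | varMul z u => (gaps u).modifyHead (fun l => z :: l)
  | brMul _ v => [] :: gaps v

/-- The `P`-breadth `|u|_P = r` of `u = u₀⌊u₁*⌋u₁ ⋯ ⌊uᵣ*⌋uᵣ`. -/
def breadthP (u : OpWord Z) : ℕ := u.stars.length

/-- The strict degree lexicographic order on the free monoid on `Z` (the empty word is smallest). -/
def ListDlexLT [LT Z] (a b : List Z) : Prop :=
  a.length < b.length ∨ (a.length = b.length ∧ List.Lex (· < ·) a b)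

/-- `u <_db v`: compare `deg_P`, then `|·|_P`, then the tuples `(u₁*, …, uᵣ*, u₀, …, uᵣ)`
lexicographically, the `uᵢ*` by `<_db` itself and the `uᵢ` by the degree lexicographic order. -/
inductive DbLT [LT Z] : OpWord Z → OpWord Z → Prop
  | degP_lt {u v : OpWord Z} (h : degP u < degP v) : DbLT u v
  | breadthP_lt {u v : OpWord Z} (h₁ : degP u = degP v) (h₂ : breadthP u < breadthP v) : DbLT u v
  | stars_lt {u v : OpWord Z} (h₁ : degP u = degP v) (h₂ : breadthP u = breadthP v)
      (h₃ : List.Lex DbLT (stars u) (stars v)) : DbLT u v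
  | gaps_lt {u v : OpWord Z} (h₁ : degP u = degP v) (h₂ : stars u = stars v)
      (h₃ : List.Lex ListDlexLT (gaps u) (gaps v)) : DbLT u v

end OpWord

/-! ### Words with one marked place -/

/-- `𝔖⋆(Z)`: the elements of `𝔖(Z ∪ {⋆})` in which `⋆` (here `none`) occurs exactly once. -/
def StarWord (Z : Type*) : Type _ :=
  {q : OpWord (Option Z) // q.letters.countP Option.isNone = 1}

/-- `q|_u`: replace the symbol `⋆` in `q` by `u`. -/
def StarWord.plug {Z : Type*} (q : StarWord Z) (u : OpWord Z) : OpWord Z :=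
  q.1.subst fun o => o.elim u OpWord.var

section Algebra

variable {k : Type*} [Field k] {Z : Type*}

/-- The linear operator `⌊ ⌋` of the free operated algebra `k𝔖(Z)`. -/
noncomputable def bracket : MonoidAlgebra k (OpWord Z) →ₗ[k] MonoidAlgebra k (OpWord Z) :=
  MonoidAlgebra.mapDomainLinearMap k k OpWord.br

/-- The linear extension of `u ↦ q|_u` to `k𝔖(Z)`. -/
noncomputable def plugPoly (q : StarWord Z) :
    MonoidAlgebra k (OpWord Z) →ₗ[k] MonoidAlgebra k (OpWord Z) :=
  MonoidAlgebra.mapDomainLinearMap k k q.plug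

/-! ### Operated Gröbner-Shirshov bases -/

/-- `r` is the strict part of a monomial order on `𝔖(Z)`. -/
def IsMonomialOrder (r : OpWord Z → OpWord Z → Prop) : Prop :=
  IsWellOrder (OpWord Z) r ∧
    ∀ u v : OpWord Z, r u v → ∀ q : StarWord Z, r (q.plug u) (q.plug v)

/-- `m` is the leading monomial of the (hence nonzero) element `f`. -/
def IsLeading (r : OpWord Z → OpWord Z → Prop) (f : MonoidAlgebra k (OpWord Z)) (m : OpWord Z) :
    Prop :=
  m ∈ f.coeff.support ∧ ∀ m' ∈ f.coeff.support, m' ≠ m → r m' m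

/-- `f` is trivial modulo `(G, w)`: it is a linear combination of elements `q|_s` with `s ∈ G`
and `q|_{s̄} < w`. -/
def IsTrivialMod (r : OpWord Z → OpWord Z → Prop) (G : Set (MonoidAlgebra k (OpWord Z)))
    (w : OpWord Z) (f : MonoidAlgebra k (OpWord Z)) : Prop :=
  f ∈ Submodule.span k {h : MonoidAlgebra k (OpWord Z) |
    ∃ s ∈ G, ∃ m : OpWord Z, IsLeading r s m ∧
      ∃ q : StarWord Z, r (q.plug m) w ∧ h = plugPoly q s}

/-- `G` is an operated Gröbner-Shirshov basis in `k𝔖(Z)` with respect to the monomial order with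
strict part `r`: all intersection compositions and all inclusion compositions of elements of `G`,
made monic, are trivial. -/
def IsOperatedGSBasis (r : OpWord Z → OpWord Z → Prop) (G : Set (MonoidAlgebra k (OpWord Z))) :
    Prop :=
  IsMonomialOrder r ∧
    ∀ f ∈ G, ∀ g ∈ G, ∀ a b : OpWord Z, IsLeading r f a → IsLeading r g b →
      (∀ w u v : OpWord Z, w = a * u → w = v * b →
        max a.breadth b.breadth < w.breadth → w.breadth < a.breadth + b.breadth →
        IsTrivialMod r G w
          (((f.coeff a)⁻¹ • f) * MonoidAlgebra.single u 1 -
            MonoidAlgebra.single v 1 * ((g.coeff b)⁻¹ • g))) ∧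
      (∀ (w : OpWord Z) (q : StarWord Z), w = a → w = q.plug b →
        IsTrivialMod r G w
          ((f.coeff a)⁻¹ • f - plugPoly q ((g.coeff b)⁻¹ • g)))

/-! ### Operated polynomial identities -/

/-- `φ ↦ φ(u)`: substitute the words `u x` for the variables `x ∈ X`. -/
noncomputable def substPoly {X : Type*} (u : X → OpWord Z) :
    MonoidAlgebra k (OpWord X) →ₗ[k] MonoidAlgebra k (OpWord Z) :=
  MonoidAlgebra.mapDomainLinearMap k k (OpWord.subst u)

/-- `S_Φ(𝔖(Z))`: the set of all `φ(u₁, …, uₙ)` with `φ ∈ Φ` and `u₁, …, uₙ ∈ 𝔖(Z)`. -/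
def instances (Z : Type*) {X : Type*} (Φ : Set (MonoidAlgebra k (OpWord X))) :
    Set (MonoidAlgebra k (OpWord Z)) :=
  {f | ∃ φ ∈ Φ, ∃ u : X → OpWord Z, f = substPoly u φ}

/-- The family `Φ ⊆ k𝔖(X)` is GS on `k𝔖(Z)` with respect to the monomial order with strict
part `r`. -/
def IsGS {X : Type*} (r : OpWord Z → OpWord Z → Prop) (Φ : Set (MonoidAlgebra k (OpWord X))) :
    Prop :=
  IsOperatedGSBasis r (instances Z Φ)

end Algebra

section OPI

variable {k : Type*} [Field k]

/-- The variable `x` of `k𝔖({x, y})`. -/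
noncomputable def opiX : MonoidAlgebra k (OpWord (Fin 2)) := MonoidAlgebra.single (OpWord.var 0) 1

/-- The variable `y` of `k𝔖({x, y})`. -/
noncomputable def opiY : MonoidAlgebra k (OpWord (Fin 2)) := MonoidAlgebra.single (OpWord.var 1) 1

/-- `⌊x⌋⌊y⌋ - l (x⌊y⌋ + ⌊x⌋y) + m ⌊xy⌋ + n xy`. -/
noncomputable def opiN1a (l m n : k) : MonoidAlgebra k (OpWord (Fin 2)) :=
  bracket opiX * bracket opiY - l • (opiX * bracket opiY + bracket opiX * opiY)
    + m • bracket (opiX * opiY) + n • (opiX * opiY)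

/-- `x⌊y⌋ - ⌊xy⌋ + ⌊x⌋y - l xy`. -/
noncomputable def opiN1b (l : k) : MonoidAlgebra k (OpWord (Fin 2)) :=
  opiX * bracket opiY - bracket (opiX * opiY) + bracket opiX * opiY - l • (opiX * opiY)

/-- `⌊xy⌋ - l xy`. -/
noncomputable def opiN1c (l : k) : MonoidAlgebra k (OpWord (Fin 2)) :=
  bracket (opiX * opiY) - l • (opiX * opiY)

/-- `⌊x⌋⌊y⌋ - l (x⌊y⌋ + ⌊x⌋y) + m ⌊yx⌋ + l² xy - l m yx`. -/
noncomputable def opiN2a (l m : k) : MonoidAlgebra k (OpWord (Fin 2)) :=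
  bracket opiX * bracket opiY - l • (opiX * bracket opiY + bracket opiX * opiY)
    + m • bracket (opiY * opiX) + l ^ 2 • (opiX * opiY) - (l * m) • (opiY * opiX)

/-- `⌊xy⌋ - l xy`. -/
noncomputable def opiN2b (l : k) : MonoidAlgebra k (OpWord (Fin 2)) :=
  bracket (opiX * opiY) - l • (opiX * opiY)

/-- `x⌊y⌋ - ⌊xy⌋`. -/
noncomputable def opiN3 : MonoidAlgebra k (OpWord (Fin 2)) :=
  opiX * bracket opiY - bracket (opiX * opiY)

/-- `⌊x⌋y - ⌊xy⌋`. -/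
noncomputable def opiN4 : MonoidAlgebra k (OpWord (Fin 2)) :=
  bracket opiX * opiY - bracket (opiX * opiY)

end OPI

end OperatedGS

namespace OperatedGS

namespace OpWord

variable {Z : Type*}

/-! ### Degrees of products -/

/-! Every monomial of every identity contains x and y exactly once, so each term of an instance φ(u,
v) is a one-hole context in u and in v. This settles most compositions uniformly: if the leading
monomial of some g ∈ G occurs inside an argument of φ, rewriting it before or after applying φ gives
the same result up to trivial elements (`sub_map_mem_trivialMod`).

Levi's lemma (`mul_eq_mul_cases`) and its version for marked factors (`IsCtx.eq_mul`) then leave one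
family of compositions for each shape of leading monomial: the overlap ⌊a⌋⌊b⌋⌊d⌋ for ⌊x⌋⌊y⌋; the
inclusion of a⌊v⌋ in ca⌊v⌋ for x⌊y⌋, and its mirror image for ⌊x⌋y; and for ⌊xy⌋ two factorizations
of the same word, whose instances coincide. Each remaining family is an explicit linear combination
of instances whose leading monomials are smaller than w.

For the orders, comparing `degP` first is what gives well-foundedness: below a given word the number
of brackets is bounded, and the words inside brackets have strictly fewer of them, so one can induct
on that bound. Compatibility with contexts is checked on products and brackets, using formulas for
the degrees of a product. -/

@[simp] theorem breadth_mul (u v : OpWord Z) : (u * v).breadth = u.breadth + v.breadth := by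
  induction u with
  | var z => simp [breadth]; omega
  | br u _ => simp [breadth]; omega
  | varMul z u ih => simp [breadth, ih]; omega
  | brMul u u' _ ih => simp [breadth, ih]; omega

theorem breadth_pos (u : OpWord Z) : 0 < u.breadth := by
  cases u <;> simp [breadth]

@[simp] theorem letters_mul (u v : OpWord Z) : (u * v).letters = u.letters ++ v.letters := by
  induction u with
  | var z => simp [letters]
  | br u _ => simp [letters]
  | varMul z u ih => simp [letters, ih]
  | brMul u u' _ ih => simp [letters, ih]

@[simp] theorem degX_mul (u v : OpWord Z) : (u * v).degX = u.degX + v.degX := by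
  simp [degX]

@[simp] theorem degX_var (z : Z) : (var z).degX = 1 := rfl

@[simp] theorem degX_br (u : OpWord Z) : (br u).degX = u.degX := rfl

@[simp] theorem degX_varMul (z : Z) (u : OpWord Z) : (varMul z u).degX = u.degX + 1 := rfl

@[simp] theorem degX_brMul (u v : OpWord Z) : (brMul u v).degX = u.degX + v.degX := by
  simp [degX, letters]

theorem degX_pos (u : OpWord Z) : 0 < u.degX := by
  induction u <;> simp <;> omega

@[simp] theorem degP_mul (u v : OpWord Z) : (u * v).degP = u.degP + v.degP := by
  induction u with
  | var z => simp [degP]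
  | br u _ => simp [degP]
  | varMul z u ih => simp [degP, ih]
  | brMul u u' _ ih => simp [degP, ih]; omega

theorem degGAux_eq (n : ℕ) (u : OpWord Z) : degGAux n u = degG u + 2 * n * u.degP := by
  unfold degG
  induction u generalizing n with
  | var z => simp [degGAux, degP]
  | br u ih => simp only [degGAux, degP]; rw [ih n]; ring
  | varMul z u ih => simp only [degGAux, degP]; rw [ih (n + 1), ih (0 + 1)]; ring
  | brMul u u' ih ih' =>
    simp only [degGAux, degP]; rw [ih n, ih' (n + degX u), ih' (0 + degX u)]; ring

theorem degG_br (u : OpWord Z) : degG (br u) = degG u + u.degX := by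
  simp [degG, degGAux]

theorem degG_var (z : Z) : degG (var z) = 0 := rfl

theorem degG_varMul (z : Z) (u : OpWord Z) : degG (varMul z u) = degG u + 2 * u.degP := by
  rw [degG, degGAux, degGAux_eq]

theorem degG_brMul (u v : OpWord Z) :
    degG (brMul u v) = degG u + u.degX + degG v + 2 * u.degX * v.degP := by
  rw [degG, degGAux, degGAux_eq, degGAux_eq]; ring

-- Each bracket of v has two half brackets, and each of them gains the letters of u on its left. The
-- correction involves only `degX u` and `degP v`, so among words that agree in `degP` and `degX`
-- multiplication preserves comparisons of `degG`.
@[simp] theorem degG_mul (u v : OpWord Z) :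
    degG (u * v) = degG u + degG v + 2 * u.degX * v.degP := by
  induction u with
  | var z => simp [degG_varMul, degG_var]
  | br u _ => simp [degG_brMul, degG_br]
  | varMul z u ih => simp [degG_varMul, ih]; ring
  | brMul u u' _ ih => simp [degG_brMul, ih]; ring

theorem degGAux'_eq (n : ℕ) (u : OpWord Z) : degGAux' n u = degG' u + 2 * n * u.degP := by
  unfold degG'
  induction u generalizing n with
  | var z => simp [degGAux', degP]
  | br u ih => simp only [degGAux', degP]; rw [ih n]; ring
  | varMul z u ih => simp only [degGAux', degP]; rw [ih n]
  | brMul u u' ih ih' =>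
    simp only [degGAux', degP]; rw [ih (degX u' + n), ih (degX u' + 0), ih' n]; ring

theorem degG'_br (u : OpWord Z) : degG' (br u) = degG' u + u.degX := by
  simp [degG', degGAux']; ring

theorem degG'_var (z : Z) : degG' (var z) = 0 := rfl

theorem degG'_varMul (z : Z) (u : OpWord Z) : degG' (varMul z u) = degG' u := rfl

theorem degG'_brMul (u v : OpWord Z) :
    degG' (brMul u v) = degG' u + u.degX + degG' v + 2 * v.degX * (u.degP + 1) := by
  rw [degG', degGAux', degGAux'_eq, degGAux'_eq]; ring

@[simp] theorem degG'_mul (u v : OpWord Z) :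
    degG' (u * v) = degG' u + degG' v + 2 * v.degX * u.degP := by
  induction u with
  | var z => simp [degG'_varMul, degG'_var, degP]
  | br u _ => simp [degG'_brMul, degG'_br, degP]
  | varMul z u ih => simp [degG'_varMul, ih, degP]
  | brMul u u' _ ih => simp [degG'_brMul, ih, degP]; ring

/-! ### Well-foundedness from fibres -/

/-- Everything reachable downwards from b has f-value at most f b, so the relation restricted to f <
f b + 1 already decides whether b is accessible. -/
theorem wellFounded_of_lt_or_eq {α : Type*} {r : α → α → Prop} (f : α → ℕ)
    (hle : ∀ a b, r a b → f a ≤ f b) (hwf : ∀ n, WellFounded fun a b => f a < n ∧ r a b) :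
    WellFounded r := by
  refine ⟨fun b => ?_⟩
  have : ∀ b', f b' ≤ f b → Acc r b' := by
    intro b'
    refine (hwf (f b + 1)).induction (C := fun b' => f b' ≤ f b → Acc r b') b' ?_
    intro x ih hx
    exact ⟨x, fun y hy => ih y ⟨by have := hle y x hy; omega, hy⟩ ((hle y x hy).trans hx)⟩
  exact this b le_rfl

/-! ### The order `Dlex` -/

/-- The letters of a word over the alphabet `Z ⊔ ⌊𝔖(Z)⌋`. -/
def toList : OpWord Z → List (Z ⊕ OpWord Z)
  | .var z => [.inl z]
  | .br u => [.inr u]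
  | .varMul z u => .inl z :: toList u
  | .brMul u v => .inr u :: toList v

theorem length_toList (u : OpWord Z) : u.toList.length = u.breadth := by
  induction u <;> simp_all [toList, breadth]

section Dlex

theorem LexLT_trichotomous [LinearOrder Z] (u v : OpWord Z) (h : u.breadth = v.breadth) :
    LexLT u v ∨ u = v ∨ LexLT v u := by
  induction u generalizing v with
  | var z =>
    cases v with
    | var z' => simpa [LexLT] using lt_trichotomy z z'
    | br v => simp [LexLT]
    | varMul z' v => have := v.breadth_pos; simp [breadth] at h; omega
    | brMul v v' => have := v'.breadth_pos; simp [breadth] at h; omega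
  | br u ih =>
    cases v with
    | var z' => simp [LexLT]
    | br v =>
      rcases lt_trichotomy u.breadth v.breadth with h' | h' | h'
      · simp [LexLT, h']
      · simpa [LexLT, h'] using ih v h'
      · simp [LexLT, h']
    | varMul z' v => have := v.breadth_pos; simp [breadth] at h; omega
    | brMul v v' => have := v'.breadth_pos; simp [breadth] at h; omega
  | varMul z u ih =>
    cases v with
    | var z' => have := u.breadth_pos; simp [breadth] at h; omega
    | br v => have := u.breadth_pos; simp [breadth] at h; omega
    | varMul z' v =>
      have h1 := ih v (by simpa [breadth] using h)
      rcases lt_trichotomy z z' with h' | rfl | h'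
      · simp [LexLT, h']
      · simpa [LexLT] using h1
      · simp [LexLT, h']
    | brMul v v' => simp [LexLT]
  | brMul u u' ih ih' =>
    cases v with
    | var z' => have := u'.breadth_pos; simp [breadth] at h; omega
    | br v => have := u'.breadth_pos; simp [breadth] at h; omega
    | varMul z' v => simp [LexLT]
    | brMul v v' =>
      have h1 := ih' v' (by simpa [breadth] using h)
      rcases lt_trichotomy u.breadth v.breadth with h' | h' | h'
      · simp [LexLT, h']
      · rcases ih v h' with h2 | rfl | h2
        · simp [LexLT, h', h2]
        · rcases h1 with h1 | rfl | h1 <;> simp_all [LexLT]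
        · simp [LexLT, h', h2]
      · simp [LexLT, h']

variable [LinearOrder Z]

theorem DlexLT_trichotomous (u v : OpWord Z) : DlexLT u v ∨ u = v ∨ DlexLT v u := by
  rcases lt_trichotomy u.breadth v.breadth with h' | h' | h'
  · simp [DlexLT, h']
  · simpa [DlexLT, h'] using LexLT_trichotomous u v h'
  · simp [DlexLT, h']

theorem LexLT.mul_left {u v : OpWord Z} (h : LexLT u v) (c : OpWord Z) :
    LexLT (c * u) (c * v) := by
  induction c with
  | var z => simp [LexLT, h]
  | br c _ => simp [LexLT, h]
  | varMul z c ih => simp [LexLT, ih]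
  | brMul c c' _ ih => simp [LexLT, ih]

theorem LexLT.mul_right {u v : OpWord Z} (hb : u.breadth = v.breadth) (h : LexLT u v)
    (c : OpWord Z) : LexLT (u * c) (v * c) := by
  induction u generalizing v with
  | var z => cases v <;> simp_all [LexLT]
  | br u ih => cases v <;> simp_all [LexLT]
  | varMul z u ih =>
    cases v with
    | varMul z' v =>
      simp only [LexLT, breadth, varMul_mul] at *
      rcases h with h | ⟨rfl, h⟩
      · exact .inl h
      · exact .inr ⟨rfl, ih (by omega) h⟩
    | _ => simp_all [LexLT]
  | brMul u u' ih ih' =>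
    cases v with
    | brMul v v' =>
      simp only [LexLT, breadth, brMul_mul] at *
      rcases h with h | ⟨rfl, h⟩
      · exact .inl h
      · exact .inr ⟨rfl, ih' (by omega) h⟩
    | _ => simp_all [LexLT]

theorem DlexLT.mul_left {u v : OpWord Z} (h : DlexLT u v) (c : OpWord Z) :
    DlexLT (c * u) (c * v) := by
  rcases h with h | ⟨h, h'⟩
  · exact .inl (by simpa using h)
  · exact .inr ⟨by simpa using h, h'.mul_left c⟩

theorem DlexLT.mul_right {u v : OpWord Z} (h : DlexLT u v) (c : OpWord Z) :
    DlexLT (u * c) (v * c) := by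
  rcases h with h | ⟨h, h'⟩
  · exact .inl (by simpa using h)
  · exact .inr ⟨by simpa using h, h'.mul_right h c⟩

theorem DlexLT.br {u v : OpWord Z} (h : DlexLT u v) : DlexLT (br u) (br v) :=
  .inr ⟨rfl, h⟩

/-- A word with at most n brackets has bracketed letters ⌊a⌋ with a of fewer than n brackets. Hence
the comparison of letters only involves the range covered by an induction on n. -/
theorem LexLT.lex_toList {n : ℕ} {u v : OpWord Z} (hn : u.degP < n + 1)
    (hb : u.breadth = v.breadth) (h : LexLT u v) :
    List.Lex (Sum.Lex (· < ·) fun a b => a.degP < n ∧ DlexLT a b) u.toList v.toList := by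
  induction u generalizing v with
  | var z =>
    cases v with
    | var z' => exact .rel (.inl h)
    | br v => exact .rel (.sep _ _)
    | _ => exact h.elim
  | br u _ =>
    cases v with
    | br v => exact .rel (.inr ⟨by simpa [degP] using hn, h⟩)
    | _ => exact h.elim
  | varMul z u ih =>
    cases v with
    | varMul z' v =>
      rcases h with h | ⟨rfl, h⟩
      · exact .rel (.inl h)
      · exact .cons (ih hn (by simpa [breadth] using hb) h)
    | brMul v v' => exact .rel (.sep _ _)
    | _ => exact h.elim
  | brMul u u' _ ih =>
    simp only [degP] at hn
    cases v with
    | brMul v v' =>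
      rcases h with h | ⟨rfl, h⟩
      · exact .rel (.inr ⟨by omega, h⟩)
      · exact .cons (ih (by omega) (by simpa [breadth] using hb) h)
    | _ => exact h.elim

/-- The bound on `degP` cannot be dropped: zz > ⌊zz⌋ > ⌊⌊zz⌋⌋ > ⋯ descends forever in Dlex. With it,
Dlex embeds in a shortlex order over a well-founded alphabet. -/
theorem DlexLT_wellFounded [WellFoundedLT Z] (n : ℕ) :
    WellFounded fun a b : OpWord Z => a.degP < n ∧ DlexLT a b := by
  induction n with
  | zero => exact ⟨fun b => ⟨b, fun a h => by simp at h⟩⟩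
  | succ n ih =>
    refine Subrelation.wf (fun {a b} h => ?_)
      (InvImage.wf toList (List.Shortlex.wf (Sum.lex_wf wellFounded_lt ih)))
    obtain ⟨h, hb | ⟨hb, h'⟩⟩ := h
    · exact List.Shortlex.of_length_lt (by simpa [length_toList] using hb)
    · exact List.Shortlex.of_lex (by simpa [length_toList] using hb) (h'.lex_toList h hb)

end Dlex

/-! ### The orders `dl` and `dl'` -/

section Dl

variable [LinearOrder Z]

theorem DlLT.mul_left {u v : OpWord Z} (h : DlLT u v) (c : OpWord Z) : DlLT (c * u) (c * v) := by
  unfold DlLT at *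
  rcases h with h | ⟨h, h' | ⟨h', h'' | ⟨h'', h3⟩⟩⟩
  · simp [h]
  · simp [h, h']
  · simp [h, h', h'']
  · simp [h, h', h'', h3.mul_left]

theorem DlLT.mul_right {u v : OpWord Z} (h : DlLT u v) (c : OpWord Z) : DlLT (u * c) (v * c) := by
  unfold DlLT at *
  rcases h with h | ⟨h, h' | ⟨h', h'' | ⟨h'', h3⟩⟩⟩
  · simp [h]
  · simp [h, h']
  · simp [h, h', h'']
  · simp [h, h', h'', h3.mul_right]

theorem DlLT.br {u v : OpWord Z} (h : DlLT u v) : DlLT (br u) (br v) := by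
  unfold DlLT at *
  rcases h with h | ⟨h, h' | ⟨h', h'' | ⟨h'', h3⟩⟩⟩
  · simp [h, degP]
  · simp [h, h', degP]
  · simp [h, h', h'', degP, degG_br]
  · simp [h, h', h'', h3.br, degP, degG_br]

theorem DlLT'.mul_left {u v : OpWord Z} (h : DlLT' u v) (c : OpWord Z) :
    DlLT' (c * u) (c * v) := by
  unfold DlLT' at *
  rcases h with h | ⟨h, h' | ⟨h', h'' | ⟨h'', h3⟩⟩⟩
  · simp [h]
  · simp [h, h']
  · simp [h, h', h'']
  · simp [h, h', h'', h3.mul_left]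

theorem DlLT'.mul_right {u v : OpWord Z} (h : DlLT' u v) (c : OpWord Z) :
    DlLT' (u * c) (v * c) := by
  unfold DlLT' at *
  rcases h with h | ⟨h, h' | ⟨h', h'' | ⟨h'', h3⟩⟩⟩
  · simp [h]
  · simp [h, h']
  · simp [h, h', h'']
  · simp [h, h', h'', h3.mul_right]

theorem DlLT'.br {u v : OpWord Z} (h : DlLT' u v) : DlLT' (br u) (br v) := by
  unfold DlLT' at *
  rcases h with h | ⟨h, h' | ⟨h', h'' | ⟨h'', h3⟩⟩⟩
  · simp [h, degP]
  · simp [h, h', degP]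
  · simp [h, h', h'', degP, degG'_br]
  · simp [h, h', h'', h3.br, degP, degG'_br]

end Dl

theorem wellFounded_degrees (f g h : OpWord Z → ℕ) (r : OpWord Z → OpWord Z → Prop)
    (hwf : ∀ n, WellFounded fun a b => f a < n ∧ r a b) :
    WellFounded fun a b => f a < f b ∨ (f a = f b ∧ (g a < g b ∨ (g a = g b ∧
      (h a < h b ∨ (h a = h b ∧ r a b))))) := by
  refine wellFounded_of_lt_or_eq f (fun a b hab => by omega) fun n => ?_
  have key := WellFounded.prod_lex (wellFounded_lt (α := ℕ)) (WellFounded.prod_lex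
    (wellFounded_lt (α := ℕ)) (WellFounded.prod_lex (wellFounded_lt (α := ℕ)) (hwf n)))
  refine Subrelation.wf (fun {a b} hab => ?_)
    (InvImage.wf (fun a : OpWord Z => (f a, g a, h a, a)) key)
  simp only [InvImage, Prod.lex_def]
  tauto

theorem isWellOrder_degrees (f g h : OpWord Z → ℕ) (r : OpWord Z → OpWord Z → Prop)
    (htri : ∀ u v, r u v ∨ u = v ∨ r v u) (hwf : ∀ n, WellFounded fun a b => f a < n ∧ r a b) :
    IsWellOrder (OpWord Z) fun a b => f a < f b ∨ (f a = f b ∧ (g a < g b ∨ (g a = g b ∧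
      (h a < h b ∨ (h a = h b ∧ r a b))))) where
  wf := wellFounded_degrees f g h r hwf
  trichotomous a b hab hba := by grind

theorem DlLT_isWellOrder [LinearOrder Z] [WellFoundedLT Z] : IsWellOrder (OpWord Z) DlLT :=
  isWellOrder_degrees degP degX degG DlexLT DlexLT_trichotomous DlexLT_wellFounded

theorem DlLT'_isWellOrder [LinearOrder Z] [WellFoundedLT Z] : IsWellOrder (OpWord Z) DlLT' :=
  isWellOrder_degrees degP degX degG' DlexLT DlexLT_trichotomous DlexLT_wellFounded

/-! ### The order `db` -/

theorem lex_trichotomous {α : Type*} {r : α → α → Prop} (l₁ l₂ : List α)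
    (h : ∀ a ∈ l₁, ∀ b ∈ l₂, r a b ∨ a = b ∨ r b a) :
    List.Lex r l₁ l₂ ∨ l₁ = l₂ ∨ List.Lex r l₂ l₁ := by
  induction l₁ generalizing l₂ with
  | nil => cases l₂ with
    | nil => simp
    | cons b l₂ => exact .inl .nil
  | cons a l₁ ih => cases l₂ with
    | nil => exact .inr (.inr .nil)
    | cons b l₂ =>
      rcases h a (by simp) b (by simp) with h' | rfl | h'
      · exact .inl (.rel h')
      · rcases ih l₂ (fun a' ha' b' hb' => h a' (by simp [ha']) b' (by simp [hb']))
          with h' | rfl | h'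
        · exact .inl (.cons h')
        · simp
        · exact .inr (.inr (.cons h'))
      · exact .inr (.inr (.rel h'))

/-- Equal length excludes the case of a proper prefix, where appending could reverse the comparison.
-/
theorem lex_append_right {α : Type*} {r : α → α → Prop} {l₁ l₂ : List α} (h : List.Lex r l₁ l₂)
    (hl : l₁.length = l₂.length) (m₁ m₂ : List α) : List.Lex r (l₁ ++ m₁) (l₂ ++ m₂) := by
  induction h with
  | nil => simp at hl
  | rel h => exact .rel h
  | cons _ ih => exact .cons (ih (by simpa using hl))

theorem lex_mono {α : Type*} {r s : α → α → Prop} {l₁ l₂ : List α} (h : List.Lex r l₁ l₂)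
    (hs : ∀ a ∈ l₁, ∀ b, r a b → s a b) : List.Lex s l₁ l₂ := by
  induction h with
  | nil => exact .nil
  | rel h => exact .rel (hs _ (by simp) _ h)
  | cons _ ih => exact .cons (ih fun a ha => hs a (by simp [ha]))

/-! #### Stars and gaps -/

@[simp] theorem stars_mul (u v : OpWord Z) : (u * v).stars = u.stars ++ v.stars := by
  induction u with
  | var z => simp [stars]
  | br u _ => simp [stars]
  | varMul z u ih => simp [stars, ih]
  | brMul u u' _ ih => simp [stars, ih]

@[simp] theorem breadthP_mul (u v : OpWord Z) : (u * v).breadthP = u.breadthP + v.breadthP := by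
  simp [breadthP]

theorem length_gaps (u : OpWord Z) : u.gaps.length = u.breadthP + 1 := by
  unfold breadthP
  induction u <;> simp_all [gaps, stars]

theorem degP_lt_of_mem_stars {u v : OpWord Z} (h : v ∈ u.stars) : v.degP < u.degP := by
  induction u with
  | var z => simp [stars] at h
  | br u _ => simp [stars] at h; simp [h, degP]
  | varMul z u ih => exact ih h
  | brMul u u' _ ih =>
    simp only [stars, List.mem_cons] at h
    simp only [degP]
    rcases h with rfl | h
    · omega
    · have := ih h; omega

/-- `[[]]` would be the gap list of the empty word, which does not exist here. This separates z from
zv, and ⌊u⌋ from ⌊u⌋v, in `eq_of_stars_gaps`. -/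
theorem gaps_ne_singleton_nil (u : OpWord Z) : u.gaps ≠ [[]] := by
  cases u with
  | var z => simp [gaps]
  | br u => simp [gaps]
  | varMul z u => cases h : u.gaps <;> simp [gaps, h]
  | brMul u v =>
    have := length_gaps v
    cases h : v.gaps <;> simp_all [gaps]

theorem gaps_ne_nil (u : OpWord Z) : u.gaps ≠ [] := by
  intro h; have := length_gaps u; simp [h] at this

/-- Uniqueness of the decomposition u₀⌊u₁*⌋u₁⋯⌊uᵣ*⌋uᵣ; it makes db a total order. -/
theorem eq_of_stars_gaps {u v : OpWord Z} (hs : u.stars = v.stars) (hg : u.gaps = v.gaps) :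
    u = v := by
  induction u generalizing v with
  | var z =>
    cases v with
    | var z' => simp_all [gaps]
    | varMul z' v =>
      obtain ⟨a, l, h⟩ := List.exists_cons_of_ne_nil v.gaps_ne_nil
      have := v.gaps_ne_singleton_nil
      simp_all [gaps]
    | _ => simp [stars] at hs
  | br u _ =>
    cases v with
    | br v => simp_all [stars]
    | brMul v v' =>
      have := v'.gaps_ne_singleton_nil
      simp [gaps] at hg
      exact (this hg.symm).elim
    | var z => simp [stars] at hs
    | varMul z' v =>
      obtain ⟨a, l, h⟩ := List.exists_cons_of_ne_nil v.gaps_ne_nil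
      simp_all [gaps]
  | varMul z u ih =>
    obtain ⟨a, l, h⟩ := List.exists_cons_of_ne_nil u.gaps_ne_nil
    cases v with
    | var z' =>
      have := u.gaps_ne_singleton_nil
      simp_all [gaps]
    | varMul z' v =>
      obtain ⟨a', l', h'⟩ := List.exists_cons_of_ne_nil v.gaps_ne_nil
      simp only [gaps, h, h', List.modifyHead_cons, List.cons.injEq] at hg
      obtain ⟨⟨rfl, rfl⟩, rfl⟩ := hg
      rw [ih (v := v) hs (h.trans h'.symm)]
    | _ => simp [gaps, h] at hg
  | brMul u u' _ ih =>
    cases v with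
    | var z => simp [stars] at hs
    | br v =>
      have := u'.gaps_ne_singleton_nil
      simp [gaps] at hg
      exact (this hg).elim
    | varMul z' v =>
      obtain ⟨a, l, h⟩ := List.exists_cons_of_ne_nil v.gaps_ne_nil
      simp_all [gaps]
    | brMul v v' =>
      simp only [stars, gaps, List.cons.injEq, true_and] at hs hg
      rw [hs.1, ih hs.2 hg]

/-- Append a letter to the last word of a list. -/
def appendLast (z : Z) : List (List Z) → List (List Z)
  | [] => []
  | [a] => [a ++ [z]]
  | a :: b :: l => a :: appendLast z (b :: l)

theorem appendLast_cons (z : Z) (a : List Z) {l : List (List Z)} (h : l ≠ []) :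
    appendLast z (a :: l) = a :: appendLast z l := by
  cases l with
  | nil => exact (h rfl).elim
  | cons b l => rfl

theorem appendLast_modifyHead (z z' : Z) (l : List (List Z)) :
    appendLast z (l.modifyHead fun a => z' :: a) = (appendLast z l).modifyHead fun a => z' :: a := by
  rcases l with _ | ⟨a, _ | ⟨b, l⟩⟩ <;> simp [appendLast]

/-- Words are built from the left, so right multiplication is analysed one letter at a time: an
element of Z extends the last gap, a bracket opens a new empty gap. -/
theorem gaps_mul_var (u : OpWord Z) (z : Z) : (u * var z).gaps = appendLast z u.gaps := by
  induction u with
  | var z' => simp [gaps, appendLast]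
  | br u _ => simp [gaps, appendLast]
  | varMul z' u ih => simp [gaps, ih, appendLast_modifyHead]
  | brMul u u' _ ih => simp [gaps, ih, appendLast_cons _ _ u'.gaps_ne_nil]

theorem gaps_mul_br (u v : OpWord Z) : (u * br v).gaps = u.gaps ++ [[]] := by
  induction u with
  | var z' => simp [gaps]
  | br u _ => simp [gaps]
  | varMul z' u ih =>
    obtain ⟨a, l, h⟩ := List.exists_cons_of_ne_nil u.gaps_ne_nil
    simp [gaps, ih, h]
  | brMul u u' _ ih => simp [gaps, ih]

section Db

variable [LinearOrder Z]

theorem ListDlexLT.cons {a b : List Z} (h : ListDlexLT a b) (z : Z) :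
    ListDlexLT (z :: a) (z :: b) := by
  rcases h with h | ⟨h, h'⟩
  · exact .inl (by simpa using h)
  · exact .inr ⟨by simpa using h, .cons h'⟩

theorem ListDlexLT.concat {a b : List Z} (h : ListDlexLT a b) (z : Z) :
    ListDlexLT (a ++ [z]) (b ++ [z]) := by
  rcases h with h | ⟨h, h'⟩
  · exact .inl (by simpa using h)
  · exact .inr ⟨by simpa using h, lex_append_right h' h _ _⟩

theorem ListDlexLT_trichotomous (a b : List Z) : ListDlexLT a b ∨ a = b ∨ ListDlexLT b a := by
  have h := lex_trichotomous a b fun x _ y _ => lt_trichotomy x y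
  unfold ListDlexLT
  rcases lt_trichotomy a.length b.length with h' | h' | h'
  · simp [h']
  · simpa [h'] using h
  · simp [h']

theorem lex_modifyHead {l m : List (List Z)} (h : List.Lex ListDlexLT l m) (z : Z) :
    List.Lex ListDlexLT (l.modifyHead fun a => z :: a) (m.modifyHead fun a => z :: a) := by
  cases h with
  | nil => exact .nil
  | rel h => exact .rel (h.cons z)
  | cons h => exact .cons h

theorem lex_appendLast {l m : List (List Z)} (h : List.Lex ListDlexLT l m)
    (hl : l.length = m.length) (z : Z) :
    List.Lex ListDlexLT (appendLast z l) (appendLast z m) := by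
  induction h with
  | nil => simp at hl
  | @rel a l b m h =>
    rcases l with _ | ⟨a', l⟩ <;> rcases m with _ | ⟨b', m⟩
    · exact .rel (h.concat z)
    · simp at hl
    · simp at hl
    · exact .rel h
  | @cons a l m h ih =>
    have hl' : l.length = m.length := by simpa using hl
    rcases l with _ | ⟨a', l⟩ <;> rcases m with _ | ⟨b', m⟩
    · cases h
    · simp at hl'
    · simp at hl'
    · exact .cons (ih hl')

theorem DbLT.varMul {u v : OpWord Z} (h : DbLT u v) (z : Z) : DbLT (varMul z u) (varMul z v) := by
  cases h with
  | degP_lt h => exact .degP_lt h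
  | breadthP_lt h₁ h₂ => exact .breadthP_lt h₁ h₂
  | stars_lt h₁ h₂ h₃ => exact .stars_lt h₁ h₂ h₃
  | gaps_lt h₁ h₂ h₃ => exact .gaps_lt h₁ h₂ (lex_modifyHead h₃ z)

theorem DbLT.brMul {u v : OpWord Z} (h : DbLT u v) (c : OpWord Z) :
    DbLT (brMul c u) (brMul c v) := by
  cases h with
  | degP_lt h => exact .degP_lt (by simpa [degP] using h)
  | breadthP_lt h₁ h₂ =>
    exact .breadthP_lt (by simpa [degP] using h₁) (by simpa [breadthP, stars] using h₂)
  | stars_lt h₁ h₂ h₃ =>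
    exact .stars_lt (by simpa [degP] using h₁) (by simpa [breadthP, stars] using h₂) (.cons h₃)
  | gaps_lt h₁ h₂ h₃ =>
    exact .gaps_lt (by simpa [degP] using h₁) (by simpa [stars] using h₂) (.cons h₃)

theorem DbLT.mul_left {u v : OpWord Z} (h : DbLT u v) (c : OpWord Z) : DbLT (c * u) (c * v) := by
  induction c with
  | var z => exact h.varMul z
  | br c _ => exact h.brMul c
  | varMul z c ih => exact ih.varMul z
  | brMul c c' _ ih => exact ih.brMul c

theorem DbLT.br {u v : OpWord Z} (h : DbLT u v) : DbLT (br u) (br v) := by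
  have hle : u.degP ≤ v.degP := by cases h <;> omega
  rcases hle.lt_or_eq with h' | h'
  · exact .degP_lt (by simpa [degP] using h')
  -- Each side has a single star, so comparing the tuples is comparing u with v.
  · exact .stars_lt (by simpa [degP] using h') rfl (.rel h)

theorem DbLT.mul_var {u v : OpWord Z} (h : DbLT u v) (z : Z) : DbLT (u * var z) (v * var z) := by
  cases h with
  | degP_lt h => exact .degP_lt (by simpa using h)
  | breadthP_lt h₁ h₂ => exact .breadthP_lt (by simpa using h₁) (by simpa using h₂)
  | stars_lt h₁ h₂ h₃ =>
    refine .stars_lt (by simpa using h₁) (by simpa using h₂) ?_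
    simpa using lex_append_right h₃ h₂ _ _
  | gaps_lt h₁ h₂ h₃ =>
    refine .gaps_lt (by simpa using h₁) (by simpa using h₂) ?_
    rw [gaps_mul_var, gaps_mul_var]
    exact lex_appendLast h₃ (by simp [length_gaps, breadthP, h₂]) z

theorem DbLT.mul_br {u v : OpWord Z} (h : DbLT u v) (c : OpWord Z) :
    DbLT (u * OpWord.br c) (v * OpWord.br c) := by
  cases h with
  | degP_lt h => exact .degP_lt (by simpa using h)
  | breadthP_lt h₁ h₂ => exact .breadthP_lt (by simpa using h₁) (by simpa using h₂)
  | stars_lt h₁ h₂ h₃ =>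
    refine .stars_lt (by simpa using h₁) (by simpa using h₂) ?_
    simpa using lex_append_right h₃ h₂ _ _
  | gaps_lt h₁ h₂ h₃ =>
    refine .gaps_lt (by simpa using h₁) (by simpa using h₂) ?_
    rw [gaps_mul_br, gaps_mul_br]
    exact lex_append_right h₃ (by simp [length_gaps, breadthP, h₂]) _ _

theorem DbLT.mul_right {u v : OpWord Z} (h : DbLT u v) (c : OpWord Z) : DbLT (u * c) (v * c) := by
  induction c generalizing u v with
  | var z => exact h.mul_var z
  | br c _ => exact h.mul_br c
  | varMul z c ih => simpa [mul_assoc] using ih (h.mul_var z)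
  | brMul c c' _ ih => simpa [mul_assoc] using ih (h.mul_br c)

theorem DbLT_trichotomous (u v : OpWord Z) : DbLT u v ∨ u = v ∨ DbLT v u := by
  induction hn : u.degP using Nat.strong_induction_on generalizing u v with
  | _ n ih =>
    subst hn
    rcases lt_trichotomy u.degP v.degP with h | h | h
    · exact .inl (.degP_lt h)
    · rcases lt_trichotomy u.breadthP v.breadthP with h' | h' | h'
      · exact .inl (.breadthP_lt h h')
      · rcases lex_trichotomous u.stars v.stars
          (fun a ha b _ => ih _ (degP_lt_of_mem_stars ha) a b rfl) with hs | hs | hs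
        · exact .inl (.stars_lt h h' hs)
        · rcases lex_trichotomous u.gaps v.gaps
            (fun a _ b _ => ListDlexLT_trichotomous a b) with hg | hg | hg
          · exact .inl (.gaps_lt h hs hg)
          · exact .inr (.inl (eq_of_stars_gaps hs hg))
          · exact .inr (.inr (.gaps_lt h.symm hs.symm hg))
        · exact .inr (.inr (.stars_lt h.symm h'.symm hs))
      · exact .inr (.inr (.breadthP_lt h.symm h'))
    · exact .inr (.inr (.degP_lt h))

theorem ListDlexLT_wellFounded [WellFoundedLT Z] : WellFounded (ListDlexLT (Z := Z)) :=
  Subrelation.wf (fun {_ _} h => List.shortlex_def.2 h) (List.Shortlex.wf wellFounded_lt)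

/-- The stars of a word have fewer brackets than the word, so they fall under the induction
hypothesis. Tuples are compared only at equal `breadthP`, hence at equal length, where lexicographic
comparison is contained in shortlex; shortlex preserves well-foundedness while plain lex does not.
-/
theorem DbLT_wellFounded_degP_lt [WellFoundedLT Z] (n : ℕ) :
    WellFounded fun a b : OpWord Z => a.degP < n ∧ DbLT a b := by
  induction n with
  | zero => exact ⟨fun b => ⟨b, fun a h => by simp at h⟩⟩
  | succ n ih =>
    have key := WellFounded.prod_lex (wellFounded_lt (α := ℕ)) (WellFounded.prod_lex
      (wellFounded_lt (α := ℕ)) (WellFounded.prod_lex (List.Shortlex.wf ih)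
        (List.Shortlex.wf (ListDlexLT_wellFounded (Z := Z)))))
    refine Subrelation.wf (fun {a b} hab => ?_)
      (InvImage.wf (fun a : OpWord Z => (a.degP, a.breadthP, a.stars, a.gaps)) key)
    obtain ⟨hn, h⟩ := hab
    simp only [InvImage, Prod.lex_def]
    cases h with
    | degP_lt h => exact .inl h
    | breadthP_lt h₁ h₂ => exact .inr ⟨h₁, .inl h₂⟩
    | stars_lt h₁ h₂ h₃ =>
      refine .inr ⟨h₁, .inr ⟨h₂, .inl (.of_lex h₂ (lex_mono h₃ fun x hx y hxy => ⟨?_, hxy⟩))⟩⟩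
      have := degP_lt_of_mem_stars hx
      omega
    | gaps_lt h₁ h₂ h₃ =>
      exact .inr ⟨h₁, .inr ⟨by simp [breadthP, h₂], .inr ⟨h₂,
        .of_lex (by simp [length_gaps, breadthP, h₂]) h₃⟩⟩⟩

theorem DbLT_isWellOrder [WellFoundedLT Z] : IsWellOrder (OpWord Z) DbLT where
  wf := wellFounded_of_lt_or_eq degP (fun a b h => by cases h <;> omega) DbLT_wellFounded_degP_lt
  trichotomous a b h h' := ((DbLT_trichotomous a b).resolve_left h).resolve_right h'

end Db

/-! ### Contexts -/

/-- The one-hole contexts: the maps `u ↦ q|_u` with `q ∈ 𝔖⋆(Z)`. -/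
inductive IsCtx : (OpWord Z → OpWord Z) → Prop
  | id : IsCtx fun u => u
  | mulLeft (c : OpWord Z) {F : OpWord Z → OpWord Z} : IsCtx F → IsCtx fun u => c * F u
  | mulRight (c : OpWord Z) {F : OpWord Z → OpWord Z} : IsCtx F → IsCtx fun u => F u * c
  | br {F : OpWord Z → OpWord Z} : IsCtx F → IsCtx fun u => br (F u)

theorem IsCtx.comp {F G : OpWord Z → OpWord Z} (hF : IsCtx F) (hG : IsCtx G) :
    IsCtx fun u => F (G u) := by
  induction hF with
  | id => exact hG
  | mulLeft c _ ih => exact ih.mulLeft c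
  | mulRight c _ ih => exact ih.mulRight c
  | br _ ih => exact ih.br

theorem subst_eq_const {q : OpWord (Option Z)} (h : q.letters.countP Option.isNone = 0) :
    ∃ c : OpWord Z, (fun u => q.subst fun o => o.elim u OpWord.var) = fun _ => c := by
  induction q with
  | var o =>
    cases o with
    | none => simp [letters] at h
    | some z => exact ⟨var z, rfl⟩
  | br q ih =>
    obtain ⟨c, hc⟩ := ih h
    exact ⟨OpWord.br c, funext fun u => congrArg OpWord.br (congrFun hc u)⟩
  | varMul o q ih =>
    cases o with
    | none => simp [letters] at h
    | some z =>
      obtain ⟨c, hc⟩ := ih (by simpa [letters] using h)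
      exact ⟨var z * c, funext fun u => congrArg (var z * ·) (congrFun hc u)⟩
  | brMul q q' ih ih' =>
    simp only [letters, List.countP_append, Nat.add_eq_zero_iff] at h
    obtain ⟨c, hc⟩ := ih h.1
    obtain ⟨c', hc'⟩ := ih' h.2
    exact ⟨OpWord.br c * c', funext fun u =>
      congrArg₂ (OpWord.br · * ·) (congrFun hc u) (congrFun hc' u)⟩

theorem isCtx_subst {q : OpWord (Option Z)} (h : q.letters.countP Option.isNone = 1) :
    IsCtx fun u : OpWord Z => q.subst fun o => o.elim u OpWord.var := by
  induction q with
  | var o =>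
    cases o with
    | none => exact .id
    | some z => simp [letters] at h
  | br q ih => exact (ih h).br
  | varMul o q ih =>
    cases o with
    | none =>
      obtain ⟨c, hc⟩ := subst_eq_const (q := q) (by simpa [letters] using h)
      have : (fun u : OpWord Z => (varMul none q).subst fun o => o.elim u OpWord.var) =
          fun u => u * c := funext fun u => congrArg (u * ·) (congrFun hc u)
      rw [this]
      exact IsCtx.id.mulRight c
    | some z => exact (ih (by simpa [letters] using h)).mulLeft (var z)
  | brMul q q' ih ih' =>
    simp only [letters, List.countP_append, Nat.add_eq_one_iff] at h
    rcases h with ⟨h, h'⟩ | ⟨h, h'⟩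
    · obtain ⟨c, hc⟩ := subst_eq_const h
      have : (fun u : OpWord Z => (brMul q q').subst fun o => o.elim u OpWord.var) =
          fun u => OpWord.br c * q'.subst fun o => o.elim u OpWord.var :=
        funext fun u => congrArg (OpWord.br · * _) (congrFun hc u)
      rw [this]
      exact (ih' h').mulLeft _
    · obtain ⟨c, hc⟩ := subst_eq_const h'
      have : (fun u : OpWord Z => (brMul q q').subst fun o => o.elim u OpWord.var) =
          fun u => OpWord.br (q.subst fun o => o.elim u OpWord.var) * c :=
        funext fun u => congrArg (_ * ·) (congrFun hc u)
      rw [this]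
      exact (ih h).br.mulRight _

theorem isCtx_plug (q : StarWord Z) : IsCtx q.plug := isCtx_subst q.2

theorem subst_mul {W : Type*} (σ : Z → OpWord W) (u v : OpWord Z) :
    (u * v).subst σ = u.subst σ * v.subst σ := by
  induction u with
  | var z => rfl
  | br u _ => rfl
  | varMul z u ih => simp [subst, ih, mul_assoc]
  | brMul u u' _ ih => simp [subst, ih]

theorem exists_subst_eq (c : OpWord Z) : ∃ q : OpWord (Option Z),
    q.letters.countP Option.isNone = 0 ∧
      ∀ u : OpWord Z, (q.subst fun o => o.elim u OpWord.var) = c := by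
  induction c with
  | var z => exact ⟨var (some z), by simp [letters], fun u => rfl⟩
  | br c ih =>
    obtain ⟨q, hq, h⟩ := ih
    exact ⟨OpWord.br q, hq, fun u => congrArg OpWord.br (h u)⟩
  | varMul z c ih =>
    obtain ⟨q, hq, h⟩ := ih
    exact ⟨varMul (some z) q, by simpa [letters] using hq, fun u => congrArg (var z * ·) (h u)⟩
  | brMul c c' ih ih' =>
    obtain ⟨q, hq, h⟩ := ih
    obtain ⟨q', hq', h'⟩ := ih'
    exact ⟨brMul q q', by simp [letters, hq, hq'], fun u =>
      congrArg₂ (OpWord.br · * ·) (h u) (h' u)⟩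

/-- Together with `isCtx_plug` this replaces star words by maps built from products and brackets,
which compose and allow induction. -/
theorem IsCtx.exists_plug {F : OpWord Z → OpWord Z} (hF : IsCtx F) :
    ∃ q : StarWord Z, q.plug = F := by
  induction hF with
  | id => exact ⟨⟨var none, by simp [letters]⟩, rfl⟩
  | mulLeft c _ ih =>
    obtain ⟨q, rfl⟩ := ih
    obtain ⟨p, hp, h⟩ := exists_subst_eq c
    exact ⟨⟨p * q.1, by simp [hp, q.2]⟩, funext fun u => by simp [StarWord.plug, subst_mul, h]⟩
  | mulRight c _ ih =>
    obtain ⟨q, rfl⟩ := ih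
    obtain ⟨p, hp, h⟩ := exists_subst_eq c
    exact ⟨⟨q.1 * p, by simp [hp, q.2]⟩, funext fun u => by simp [StarWord.plug, subst_mul, h]⟩
  | br _ ih =>
    obtain ⟨q, rfl⟩ := ih
    exact ⟨⟨OpWord.br q.1, q.2⟩, rfl⟩

/-! ### Factorizations -/

/-- Levi's lemma for the free semigroup on Z ⊔ ⌊𝔖(Z)⌋: the two cuts of the common word coincide, or
one precedes the other and t is the piece between them. -/
theorem mul_eq_mul_cases {a b c d : OpWord Z} (h : a * b = c * d) :
    (a = c ∧ b = d) ∨ (∃ t, c = a * t ∧ b = t * d) ∨ ∃ t, a = c * t ∧ d = t * b := by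
  induction a generalizing c with
  | var z =>
    cases c with
    | varMul z' c => simp_all
    | _ => simp_all
  | br a _ =>
    cases c with
    | brMul c c' => simp_all
    | _ => simp_all
  | varMul z a ih =>
    cases c with
    | var z' => simp_all
    | varMul z' c =>
      simp only [varMul_mul, varMul.injEq] at h
      rcases ih h.2 with ⟨rfl, h'⟩ | ⟨t, rfl, h'⟩ | ⟨t, rfl, h'⟩ <;> simp_all
    | _ => simp_all
  | brMul a a' _ ih =>
    cases c with
    | br c => simp_all
    | brMul c c' =>
      simp only [brMul_mul, brMul.injEq] at h
      rcases ih h.2 with ⟨rfl, h'⟩ | ⟨t, rfl, h'⟩ | ⟨t, rfl, h'⟩ <;> simp_all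
    | _ => simp_all

theorem mul_ne_br (u v w : OpWord Z) : u * v ≠ br w := by
  cases u <;> simp

theorem mul_br_inj {a b c d : OpWord Z} (h : a * br b = c * br d) : a = c ∧ b = d := by
  rcases mul_eq_mul_cases h with ⟨rfl, h'⟩ | ⟨t, _, h'⟩ | ⟨t, _, h'⟩
  · exact ⟨rfl, br.inj h'⟩
  · exact (mul_ne_br _ _ _ h'.symm).elim
  · exact (mul_ne_br _ _ _ h'.symm).elim

/-- Multiplication on the left by a possibly empty word. -/
def preMul (p : Option (OpWord Z)) (u : OpWord Z) : OpWord Z := p.elim u (· * u)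

/-- Multiplication on the right by a possibly empty word. -/
def postMul (u : OpWord Z) (s : Option (OpWord Z)) : OpWord Z := s.elim u (u * ·)

theorem br_eq_preMul {u v : OpWord Z} {p : Option (OpWord Z)} (h : br u = preMul p v) :
    p = none ∧ v = br u := by
  cases p with
  | none => exact ⟨rfl, h.symm⟩
  | some p => exact (mul_ne_br _ _ _ h.symm).elim

theorem br_eq_postMul {u v : OpWord Z} {s : Option (OpWord Z)} (h : br u = postMul v s) :
    s = none ∧ v = br u := by
  cases s with
  | none => exact ⟨rfl, h.symm⟩
  | some s => exact (mul_ne_br _ _ _ h.symm).elim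

theorem IsCtx.eq_br {F : OpWord Z → OpWord Z} (hF : IsCtx F) {b U : OpWord Z}
    (h : F b = OpWord.br U) :
    (F = (fun u => u) ∧ b = OpWord.br U) ∨
      ∃ F', IsCtx F' ∧ F = (fun u => OpWord.br (F' u)) ∧ F' b = U := by
  cases hF with
  | id => exact .inl ⟨rfl, h⟩
  | mulLeft c _ => exact (mul_ne_br _ _ _ h).elim
  | mulRight c _ => exact (mul_ne_br _ _ _ h).elim
  | @br F' hF' => exact .inr ⟨F', hF', rfl, br.inj h⟩

/-- If a product `UV` contains a marked factor `b`, then `b` lies in `U`, or in `V`, or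
meets both. -/
theorem IsCtx.eq_mul {F : OpWord Z → OpWord Z} (hF : IsCtx F) {b U V : OpWord Z}
    (h : F b = U * V) :
    (∃ F', IsCtx F' ∧ F = (fun u => F' u * V) ∧ F' b = U) ∨
      (∃ F', IsCtx F' ∧ F = (fun u => U * F' u) ∧ F' b = V) ∨
      ∃ b₁ b₂ p s, b = b₁ * b₂ ∧ F = (fun u => preMul p (postMul u s)) ∧
        U = preMul p b₁ ∧ V = postMul b₂ s := by
  induction hF generalizing U V with
  | id => exact .inr (.inr ⟨U, V, none, none, h, rfl, rfl, rfl⟩)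
  | @mulLeft c F hF ih =>
    rcases mul_eq_mul_cases h with ⟨rfl, h'⟩ | ⟨t, rfl, h'⟩ | ⟨t, rfl, h'⟩
    · exact .inr (.inl ⟨F, hF, rfl, h'⟩)
    · rcases ih h' with ⟨F', hF', rfl, rfl⟩ | ⟨F', hF', rfl, rfl⟩ |
        ⟨b₁, b₂, p, s, rfl, rfl, rfl, rfl⟩
      · exact .inl ⟨_, hF'.mulLeft c, by simp only [mul_assoc], rfl⟩
      · exact .inr (.inl ⟨F', hF', by simp only [mul_assoc], rfl⟩)
      · refine .inr (.inr ⟨b₁, b₂, some (p.elim c (c * ·)), s, rfl, ?_, ?_, rfl⟩) <;>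
          cases p <;> simp [preMul, mul_assoc]
    · exact .inr (.inl ⟨_, hF.mulLeft t, by simp only [mul_assoc], h'.symm⟩)
  | @mulRight c F hF ih =>
    rcases mul_eq_mul_cases h with ⟨h', rfl⟩ | ⟨t, rfl, rfl⟩ | ⟨t, h', rfl⟩
    · exact .inl ⟨F, hF, rfl, h'⟩
    · exact .inl ⟨_, hF.mulRight t, by simp only [mul_assoc], rfl⟩
    · rcases ih h' with ⟨F', hF', rfl, rfl⟩ | ⟨F', hF', rfl, rfl⟩ |
        ⟨b₁, b₂, p, s, rfl, rfl, rfl, rfl⟩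
      · exact .inl ⟨F', hF', by simp only [mul_assoc], rfl⟩
      · exact .inr (.inl ⟨_, hF'.mulRight c, by simp only [mul_assoc], rfl⟩)
      · refine .inr (.inr ⟨b₁, b₂, p, some (s.elim c (· * c)), rfl, ?_, rfl, ?_⟩) <;>
          cases s <;> cases p <;> simp [postMul, preMul, mul_assoc]
  | br _ _ => exact (mul_ne_br _ _ _ h.symm).elim

/-! ### Compatibility of the three orders with contexts. -/

theorem isMonomialOrder_of_mul_br {r : OpWord Z → OpWord Z → Prop} (hr : IsWellOrder (OpWord Z) r)
    (hl : ∀ u v, r u v → ∀ c, r (c * u) (c * v)) (hr' : ∀ u v, r u v → ∀ c, r (u * c) (v * c))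
    (hb : ∀ u v, r u v → r (br u) (br v)) : IsMonomialOrder r := by
  refine ⟨hr, fun u v h q => ?_⟩
  have hq := isCtx_plug q
  generalize q.plug = F at hq
  induction hq with
  | id => exact h
  | mulLeft c _ ih => exact hl _ _ ih c
  | mulRight c _ ih => exact hr' _ _ ih c
  | br _ ih => exact hb _ _ ih

theorem DbLT_isMonomialOrder [LinearOrder Z] [WellFoundedLT Z] :
    IsMonomialOrder (DbLT (Z := Z)) :=
  isMonomialOrder_of_mul_br DbLT_isWellOrder (fun _ _ h => h.mul_left) (fun _ _ h => h.mul_right)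
    fun _ _ h => h.br

theorem DlLT_isMonomialOrder [LinearOrder Z] [WellFoundedLT Z] :
    IsMonomialOrder (DlLT (Z := Z)) :=
  isMonomialOrder_of_mul_br DlLT_isWellOrder (fun _ _ h => h.mul_left) (fun _ _ h => h.mul_right)
    fun _ _ h => h.br

theorem DlLT'_isMonomialOrder [LinearOrder Z] [WellFoundedLT Z] :
    IsMonomialOrder (DlLT' (Z := Z)) :=
  isMonomialOrder_of_mul_br DlLT'_isWellOrder (fun _ _ h => h.mul_left)
    (fun _ _ h => h.mul_right) fun _ _ h => h.br

end OpWord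

open OpWord MonoidAlgebra

/-! ### Leading monomials and trivial elements. -/

section Trivial

variable {k : Type*} [Field k] {Z : Type*} {r : OpWord Z → OpWord Z → Prop}
  {G : Set (MonoidAlgebra k (OpWord Z))}

theorem IsMonomialOrder.lt_ctx (hr : IsMonomialOrder r) {F : OpWord Z → OpWord Z} (hF : IsCtx F)
    {u v : OpWord Z} (h : r u v) : r (F u) (F v) := by
  obtain ⟨q, rfl⟩ := hF.exists_plug
  exact hr.2 u v h q

theorem IsMonomialOrder.irrefl (hr : IsMonomialOrder r) (u : OpWord Z) : ¬ r u u :=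
  fun h => hr.1.wf.asymmetric _ _ h h

/-- The elements that are trivial modulo `(G, w)`. -/
noncomputable def trivialMod (r : OpWord Z → OpWord Z → Prop) (G : Set (MonoidAlgebra k (OpWord Z)))
    (w : OpWord Z) : Submodule k (MonoidAlgebra k (OpWord Z)) :=
  Submodule.span k {h | ∃ s ∈ G, ∃ m : OpWord Z, IsLeading r s m ∧
    ∃ q : StarWord Z, r (q.plug m) w ∧ h = plugPoly q s}

theorem map_mem_trivialMod {w m : OpWord Z} {s : MonoidAlgebra k (OpWord Z)} (hs : s ∈ G)
    (hm : IsLeading r s m) {F : OpWord Z → OpWord Z} (hF : IsCtx F) (h : r (F m) w) :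
    mapDomainLinearMap k k F s ∈ trivialMod r G w := by
  obtain ⟨q, rfl⟩ := hF.exists_plug
  exact Submodule.subset_span ⟨s, hs, m, hm, q, h, rfl⟩

/-- The elements all of whose monomials are smaller than `m`. -/
noncomputable def below (k : Type*) [Field k] (r : OpWord Z → OpWord Z → Prop) (m : OpWord Z) :
    Submodule k (MonoidAlgebra k (OpWord Z)) where
  carrier := {f | ∀ c, ¬ r c m → f.coeff c = 0}
  add_mem' hf hg c hc := by simp [hf c hc, hg c hc]
  zero_mem' c _ := by simp
  smul_mem' a f hf c hc := by simp [hf c hc]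

theorem single_mem_below {u m : OpWord Z} (h : r u m) : single u (1 : k) ∈ below k r m := by
  intro c hc
  have : u ≠ c := by rintro rfl; exact hc h
  simp [this]

theorem below_le_span (m : OpWord Z) :
    below k r m ≤ Submodule.span k {f | ∃ c, r c m ∧ f = single c 1} := by
  intro f hf
  have : f = ∑ c ∈ f.coeff.support, f.coeff c • single c (1 : k) := by
    apply coeff_injective
    rw [coeff_sum]
    simpa [Finsupp.sum] using (Finsupp.sum_single f.coeff).symm
  rw [this]
  refine Submodule.sum_mem _ fun c hc => Submodule.smul_mem _ _ (Submodule.subset_span ⟨c, ?_, rfl⟩)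
  by_contra h
  exact (Finsupp.mem_support_iff.1 hc) (hf c h)

theorem coeff_single_add {m : OpWord Z} (hr : ¬ r m m) {h : MonoidAlgebra k (OpWord Z)}
    (hh : h ∈ below k r m) : (single m 1 + h).coeff m = 1 := by
  simp [hh m hr]

theorem isLeading_single_add {m : OpWord Z} (hr : ¬ r m m) {h : MonoidAlgebra k (OpWord Z)}
    (hh : h ∈ below k r m) : IsLeading r (single m 1 + h) m := by
  refine ⟨by rw [Finsupp.mem_support_iff, coeff_single_add hr hh]; exact one_ne_zero, ?_⟩
  intro m' hm' hne
  by_contra hlt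
  refine Finsupp.mem_support_iff.1 hm' ?_
  simp [hh m' hlt, hne.symm]

theorem IsLeading.sub_single_mem_below {m : OpWord Z} {g : MonoidAlgebra k (OpWord Z)}
    (hg : IsLeading r g m) (h1 : g.coeff m = 1) : g - single m 1 ∈ below k r m := by
  intro c hc
  by_cases hcm : m = c
  · subst hcm; simp [h1]
  · have : g.coeff c = 0 := by
      by_contra h
      exact hc (hg.2 c (Finsupp.mem_support_iff.2 h) (Ne.symm hcm))
    simp [this, hcm]

/-- Identifies the leading monomials quantified over in `IsOperatedGSBasis` with the prescribed
ones. -/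
theorem IsLeading.unique (hr : IsMonomialOrder r) {f : MonoidAlgebra k (OpWord Z)}
    {m m' : OpWord Z} (h : IsLeading r f m) (h' : IsLeading r f m') : m = m' := by
  by_contra hne
  exact hr.1.wf.asymmetric _ _ (h.2 m' h'.1 (Ne.symm hne)) (h'.2 m h.1 hne)

theorem single_mul_eq_map (c : OpWord Z) (f : MonoidAlgebra k (OpWord Z)) :
    single c 1 * f = mapDomainLinearMap k k (fun u => c * u) f := by
  induction f using MonoidAlgebra.induction_linear with
  | zero => simp
  | add f g hf hg => rw [mul_add, hf, hg, map_add]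
  | single u a => simp [single_mul_single]

theorem mul_single_eq_map (c : OpWord Z) (f : MonoidAlgebra k (OpWord Z)) :
    f * single c 1 = mapDomainLinearMap k k (fun u => u * c) f := by
  induction f using MonoidAlgebra.induction_linear with
  | zero => simp
  | add f g hf hg => rw [add_mul, hf, hg, map_add]
  | single u a => simp [single_mul_single]

theorem map_map (F F' : OpWord Z → OpWord Z) (f : MonoidAlgebra k (OpWord Z)) :
    mapDomainLinearMap k k F (mapDomainLinearMap k k F' f) =
      mapDomainLinearMap k k (fun u => F (F' u)) f :=
  (LinearMap.congr_fun (mapDomainLinearMap_comp (R := k) (S := k) F' F) f).symm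

theorem map_id (f : MonoidAlgebra k (OpWord Z)) :
    mapDomainLinearMap k k (fun u : OpWord Z => u) f = f := by
  apply coeff_injective
  exact Finsupp.mapDomain_id

/-- Let `P u + Σ cᵢ Fᵢ u ∈ G` for all words `u`, with leading monomial `P u`. Replacing a leading
monomial `b` inside `u` before or after applying this relation gives the same result modulo
trivial elements. -/
theorem sub_map_mem_trivialMod (hr : IsMonomialOrder r) {P : OpWord Z → OpWord Z} (hP : IsCtx P)
    {l : List (k × (OpWord Z → OpWord Z))} (hl : ∀ t ∈ l, IsCtx t.2 ∧ ∀ u, r (t.2 u) (P u))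
    (hG : ∀ u, single (P u) 1 + (l.map fun t => t.1 • single (t.2 u) (1 : k)).sum ∈ G)
    {g : MonoidAlgebra k (OpWord Z)} (hg : g ∈ G) {b : OpWord Z} (hb : IsLeading r g b)
    (hb1 : g.coeff b = 1) {Q : OpWord Z → OpWord Z} (hQ : IsCtx Q) :
    single (P (Q b)) 1 + (l.map fun t => t.1 • single (t.2 (Q b)) (1 : k)).sum -
      mapDomainLinearMap k k P (mapDomainLinearMap k k Q g) ∈ trivialMod r G (P (Q b)) := by
  set low : MonoidAlgebra k (OpWord Z) →ₗ[k] MonoidAlgebra k (OpWord Z) :=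
    (l.map fun t => t.1 • mapDomainLinearMap k k t.2).sum with hlow
  have low_single (u : OpWord Z) :
      low (single u 1) = (l.map fun t => t.1 • single (t.2 u) (1 : k)).sum := by
    rw [hlow]
    clear hlow low hl hG
    induction l with
    | nil => simp
    | cons t l ih => simp [ih]
  have low_mem (u : OpWord Z) : low (single u 1) ∈ below k r (P u) := by
    rw [low_single]
    refine list_sum_mem fun x hx => ?_
    obtain ⟨t, ht, rfl⟩ := List.mem_map.1 hx
    exact Submodule.smul_mem _ _ (single_mem_below ((hl t ht).2 u))
  -- Each lower term applied to Q(g) is a context around g, with leading monomial t(Q b) < P(Q b).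
  have h1 : low (mapDomainLinearMap k k Q g) ∈ trivialMod r G (P (Q b)) := by
    have : low (mapDomainLinearMap k k Q g) =
        (l.map fun t => t.1 • mapDomainLinearMap k k (fun u => t.2 (Q u)) g).sum := by
      rw [hlow]
      clear low_mem low_single hlow low hl hG
      induction l with
      | nil => simp
      | cons t l ih => simp [ih, map_map]
    rw [this]
    refine list_sum_mem fun x hx => ?_
    obtain ⟨t, ht, rfl⟩ := List.mem_map.1 hx
    exact Submodule.smul_mem _ _
      (map_mem_trivialMod hg hb ((hl t ht).1.comp hQ) ((hl t ht).2 (Q b)))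
  -- The tail g - b is a combination of words c < b, and P + low sends Q(c) to an element of G with
  -- leading monomial P(Q c) < P(Q b).
  have h2 : (mapDomainLinearMap k k P + low) (mapDomainLinearMap k k Q (g - single b 1)) ∈
      trivialMod r G (P (Q b)) := by
    have hle : below k r b ≤ (trivialMod r G (P (Q b))).comap
        ((mapDomainLinearMap k k P + low) ∘ₗ mapDomainLinearMap k k Q) := by
      refine (below_le_span b).trans (Submodule.span_le.2 ?_)
      rintro _ ⟨c, hc, rfl⟩
      have hmem := hG (Q c)
      rw [← low_single] at hmem
      have := map_mem_trivialMod hmem (isLeading_single_add (hr.irrefl _) (low_mem (Q c))) .id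
        (hr.lt_ctx (hP.comp hQ) hc)
      simpa [map_id] using this
    exact hle (hb.sub_single_mem_below hb1)
  -- In low(Qg) - (P + low)(Qg - Qb) the terms low(Qg) cancel, leaving (P + low)(Qb) - P(Qg).
  have := Submodule.sub_mem _ h1 h2
  rw [← low_single]
  convert this using 1
  simp only [map_sub, LinearMap.add_apply, mapDomainLinearMap_single]
  abel

end Trivial

/-! ### Relations in two variables -/

/-- A relation `lead x y + Σ cᵢ Fᵢ x y`. -/
structure BiRel (k : Type*) (Z : Type*) where
  /-- The leading monomial. -/
  lead : OpWord Z → OpWord Z → OpWord Z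
  /-- The coefficients and monomials of the other terms. -/
  terms : List (k × (OpWord Z → OpWord Z → OpWord Z))

namespace BiRel

variable {k : Type*} [Field k] {Z : Type*} {r : OpWord Z → OpWord Z → Prop}

/-- The instance of a relation at two words. -/
noncomputable def poly (R : BiRel k Z) (u v : OpWord Z) : MonoidAlgebra k (OpWord Z) :=
  single (R.lead u v) 1 + (R.terms.map fun t => t.1 • single (t.2 u v) (1 : k)).sum

/-- All the instances of a relation. -/
def set (R : BiRel k Z) : Set (MonoidAlgebra k (OpWord Z)) := {f | ∃ u v, f = R.poly u v}

/-- All monomials contain each variable once, and `lead` is the leading one. -/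
structure Admissible (R : BiRel k Z) (r : OpWord Z → OpWord Z → Prop) : Prop where
  isMonomialOrder : IsMonomialOrder r
  lead_left (v : OpWord Z) : IsCtx fun u => R.lead u v
  lead_right (u : OpWord Z) : IsCtx fun v => R.lead u v
  terms_ctx : ∀ t ∈ R.terms, (∀ v, IsCtx fun u => t.2 u v) ∧ (∀ u, IsCtx fun v => t.2 u v) ∧
    ∀ u v, r (t.2 u v) (R.lead u v)

namespace Admissible

variable {R : BiRel k Z}

/-- The listed terms may coincide or have coefficient zero, as uv and vu do for u = v; only the
comparison with the leading monomial matters. -/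
theorem low_mem (hR : R.Admissible r) (u v : OpWord Z) :
    (R.terms.map fun t => t.1 • single (t.2 u v) (1 : k)).sum ∈ below k r (R.lead u v) := by
  refine list_sum_mem fun x hx => ?_
  obtain ⟨t, ht, rfl⟩ := List.mem_map.1 hx
  exact Submodule.smul_mem _ _ (single_mem_below ((hR.terms_ctx t ht).2.2 u v))

theorem isLeading (hR : R.Admissible r) (u v : OpWord Z) :
    IsLeading r (R.poly u v) (R.lead u v) :=
  isLeading_single_add (hR.isMonomialOrder.irrefl _) (hR.low_mem u v)

theorem coeff_lead (hR : R.Admissible r) (u v : OpWord Z) :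
    (R.poly u v).coeff (R.lead u v) = 1 :=
  coeff_single_add (hR.isMonomialOrder.irrefl _) (hR.low_mem u v)

theorem map_mem (hR : R.Admissible r) {u v w : OpWord Z} {F : OpWord Z → OpWord Z} (hF : IsCtx F)
    (h : r (F (R.lead u v)) w) : mapDomainLinearMap k k F (R.poly u v) ∈ trivialMod r R.set w :=
  map_mem_trivialMod (G := R.set) ⟨u, v, rfl⟩ (hR.isLeading u v) hF h

/-- With v fixed, the relation is a one-variable relation in u, to which `sub_map_mem_trivialMod`
applies. -/
theorem sub_map_left_mem (hR : R.Admissible r) (v a b : OpWord Z) {Q : OpWord Z → OpWord Z}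
    (hQ : IsCtx Q) :
    R.poly (Q (R.lead a b)) v - mapDomainLinearMap k k (fun u => R.lead u v)
      (mapDomainLinearMap k k Q (R.poly a b)) ∈
        trivialMod r R.set (R.lead (Q (R.lead a b)) v) := by
  have := sub_map_mem_trivialMod (G := R.set) (g := R.poly a b) hR.isMonomialOrder
    (hR.lead_left v) (l := R.terms.map fun t => (t.1, fun u => t.2 u v)) (fun t ht => ?_)
    (fun u => ⟨u, v, by simp [poly, Function.comp_def]⟩) ⟨a, b, rfl⟩ (hR.isLeading a b)
    (hR.coeff_lead a b) hQ
  · simpa [poly, Function.comp_def] using this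
  · obtain ⟨t', ht', rfl⟩ := List.mem_map.1 ht
    exact ⟨(hR.terms_ctx t' ht').1 v, fun u => (hR.terms_ctx t' ht').2.2 u v⟩

theorem sub_map_right_mem (hR : R.Admissible r) (u a b : OpWord Z) {Q : OpWord Z → OpWord Z}
    (hQ : IsCtx Q) :
    R.poly u (Q (R.lead a b)) - mapDomainLinearMap k k (fun v => R.lead u v)
      (mapDomainLinearMap k k Q (R.poly a b)) ∈
        trivialMod r R.set (R.lead u (Q (R.lead a b))) := by
  have := sub_map_mem_trivialMod (G := R.set) (g := R.poly a b) hR.isMonomialOrder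
    (hR.lead_right u) (l := R.terms.map fun t => (t.1, fun v => t.2 u v)) (fun t ht => ?_)
    (fun v => ⟨u, v, by simp [poly, Function.comp_def]⟩) ⟨a, b, rfl⟩ (hR.isLeading a b)
    (hR.coeff_lead a b) hQ
  · simpa [poly, Function.comp_def] using this
  · obtain ⟨t', ht', rfl⟩ := List.mem_map.1 ht
    exact ⟨(hR.terms_ctx t' ht').2.1 u, fun v => (hR.terms_ctx t' ht').2.2 u v⟩

theorem isOperatedGSBasis (hR : R.Admissible r)
    (incl : ∀ u v a b, ∀ Q : OpWord Z → OpWord Z, IsCtx Q → Q (R.lead a b) = R.lead u v →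
      R.poly u v - mapDomainLinearMap k k Q (R.poly a b) ∈ trivialMod r R.set (R.lead u v))
    (inter : ∀ a b c d t u v, R.lead a b = v * t → R.lead c d = t * u →
      R.poly a b * single u 1 - single v 1 * R.poly c d ∈ trivialMod r R.set (v * t * u)) :
    IsOperatedGSBasis r R.set := by
  refine ⟨hR.isMonomialOrder, ?_⟩
  rintro _ ⟨a, b, rfl⟩ _ ⟨c, d, rfl⟩ m m' hm hm'
  obtain rfl := hm.unique hR.isMonomialOrder (hR.isLeading a b)
  obtain rfl := hm'.unique hR.isMonomialOrder (hR.isLeading c d)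
  simp only [hR.coeff_lead, inv_one, one_smul]
  refine ⟨fun w u v hw hw' _ hlt => ?_, fun w q hw hw' => ?_⟩
  -- If the two leading monomials do not overlap in w, then |w| is at least the sum of their
  -- breadths; only a genuine overlap t remains.
  · rcases mul_eq_mul_cases (hw.symm.trans hw') with ⟨_, h⟩ | ⟨t, h, _⟩ | ⟨t, h, h'⟩
    · rw [hw, breadth_mul, h] at hlt
      omega
    · rw [hw', h, breadth_mul, breadth_mul] at hlt
      have := t.breadth_pos
      omega
    · rw [hw, h]
      exact inter a b c d t u v h h'
  -- `IsTrivialMod` unfolds to membership in `trivialMod`.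
  · rw [hw]
    exact incl a b c d q.plug (isCtx_plug q) (hw'.symm.trans hw)

/-- Relations with leading monomial `⌊x⌋⌊y⌋`. -/
theorem isOperatedGSBasis_br_mul_br (hR : R.Admissible r)
    (hlead : R.lead = fun u v => br u * br v)
    (inter : ∀ a b d, R.poly a b * single (br d) 1 - single (br a) 1 * R.poly b d ∈
      trivialMod r R.set (br a * br b * br d)) : IsOperatedGSBasis r R.set := by
  have hl (u v : OpWord Z) : R.lead u v = br u * br v := by rw [hlead]
  refine hR.isOperatedGSBasis (fun u v a b Q hQ h => ?_) fun a b c d t u v h h' => ?_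
  · simp only [hl] at h
    rcases hQ.eq_mul h with ⟨F, hF, rfl, hFu⟩ | ⟨F, hF, rfl, hFu⟩ | ⟨b₁, b₂, p, s, hb, rfl, hp, hs⟩
    · rcases hF.eq_br hFu with ⟨_, h'⟩ | ⟨F', hF', rfl, rfl⟩
      · exact (mul_ne_br _ _ _ h').elim
      · simpa only [hl, map_map] using hR.sub_map_left_mem v a b hF'
    · rcases hF.eq_br hFu with ⟨_, h'⟩ | ⟨F', hF', rfl, rfl⟩
      · exact (mul_ne_br _ _ _ h').elim
      · simpa only [hl, map_map] using hR.sub_map_right_mem u a b hF'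
    -- A factor meeting both ⌊u⌋ and ⌊v⌋ is the whole word, so the composition is zero.
    · obtain ⟨rfl, rfl⟩ := br_eq_preMul hp
      obtain ⟨rfl, rfl⟩ := br_eq_postMul hs
      simp only [br_mul, brMul.injEq, br.injEq] at hb
      obtain ⟨rfl, rfl⟩ := hb
      simp [preMul, postMul, map_id]
  · rw [hl] at h h'
    have key {a b v t : OpWord Z} (h : br a * br b = v * t) : v = br a ∧ t = br b := by
      rcases mul_eq_mul_cases h with ⟨rfl, rfl⟩ | ⟨_, _, h⟩ | ⟨_, h, _⟩
      · exact ⟨rfl, rfl⟩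
      · exact (mul_ne_br _ _ _ h.symm).elim
      · exact (mul_ne_br _ _ _ h.symm).elim
    obtain ⟨rfl, rfl⟩ := key h
    obtain ⟨hc, rfl⟩ := key h'
    obtain rfl := br.inj hc
    exact inter a b d

/-- Relations with leading monomial `x⌊y⌋`. -/
theorem isOperatedGSBasis_mul_br (hR : R.Admissible r) (hlead : R.lead = fun u v => u * br v)
    (H : ∀ c a v, R.poly (c * a) v - single c 1 * R.poly a v ∈
      trivialMod r R.set (c * a * br v)) : IsOperatedGSBasis r R.set := by
  have hl (u v : OpWord Z) : R.lead u v = u * br v := by rw [hlead]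
  refine hR.isOperatedGSBasis (fun u v a b Q hQ h => ?_) fun a b c d t u v h h' => ?_
  · simp only [hl] at h
    rcases hQ.eq_mul h with ⟨F, hF, rfl, rfl⟩ | ⟨F, hF, rfl, hFu⟩ | ⟨b₁, b₂, p, s, hb, rfl, hp, hs⟩
    · simpa only [hl, map_map] using hR.sub_map_left_mem v a b hF
    · rcases hF.eq_br hFu with ⟨_, h'⟩ | ⟨F', hF', rfl, rfl⟩
      · exact (mul_ne_br _ _ _ h').elim
      · simpa only [hl, map_map] using hR.sub_map_right_mem u a b hF'
    -- The factor ends in ⌊v⌋ and begins inside u: it is all of u⌊v⌋, or a⌊v⌋ with u = ca, which is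
    -- the case `H`.
    · obtain ⟨rfl, rfl⟩ := br_eq_postMul hs
      obtain ⟨rfl, rfl⟩ := mul_br_inj hb
      subst hp
      cases p with
      | none => simp [preMul, postMul, map_id]
      | some c =>
        have := H c a b
        rw [single_mul_eq_map] at this
        rw [hl]
        exact this
  · rw [hl] at h h'
    -- The leading monomial a⌊b⌋ lies inside the first argument vc of (vc)⌊d⌋ = w. The intersection
    -- composition is therefore the difference of the inclusion `H v c d` and a composition inside
    -- an argument.
    obtain ⟨Q, hQ, h₁, h₂⟩ : ∃ Q : OpWord Z → OpWord Z, IsCtx Q ∧ v * c = Q (a * br b) ∧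
        ∀ x, x * u = Q x * br d := by
      rcases mul_eq_mul_cases h' with ⟨rfl, rfl⟩ | ⟨_, _, h''⟩ | ⟨s, rfl, rfl⟩
      · exact ⟨_, .id, h.symm, fun x => rfl⟩
      · exact (mul_ne_br _ _ _ h''.symm).elim
      · exact ⟨_, IsCtx.id.mulRight s, by rw [h, mul_assoc], fun x => by rw [mul_assoc]⟩
    have h₃ := hR.sub_map_left_mem d a b hQ
    simp only [hl, map_map, ← h₁, ← h₂] at h₃
    rw [← mul_single_eq_map] at h₃
    have h₄ := H v c d
    have hw : v * c * br d = v * t * u := by rw [mul_assoc, h', mul_assoc]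
    rw [hw] at h₃ h₄
    convert Submodule.sub_mem _ h₄ h₃ using 1
    abel

/-- Relations with leading monomial `⌊x⌋y`. -/
theorem isOperatedGSBasis_br_mul (hR : R.Admissible r) (hlead : R.lead = fun u v => br u * v)
    (H : ∀ u a c, R.poly u (a * c) - R.poly u a * single c 1 ∈
      trivialMod r R.set (br u * (a * c))) : IsOperatedGSBasis r R.set := by
  have hl (u v : OpWord Z) : R.lead u v = br u * v := by rw [hlead]
  refine hR.isOperatedGSBasis (fun u v a b Q hQ h => ?_) fun a b c d t u v h h' => ?_
  · simp only [hl] at h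
    rcases hQ.eq_mul h with ⟨F, hF, rfl, hFu⟩ | ⟨F, hF, rfl, rfl⟩ | ⟨b₁, b₂, p, s, hb, rfl, hp, hs⟩
    · rcases hF.eq_br hFu with ⟨_, h'⟩ | ⟨F', hF', rfl, rfl⟩
      · exact (mul_ne_br _ _ _ h').elim
      · simpa only [hl, map_map] using hR.sub_map_left_mem v a b hF'
    · simpa only [hl, map_map] using hR.sub_map_right_mem u a b hF
    · obtain ⟨rfl, rfl⟩ := br_eq_preMul hp
      simp only [br_mul, brMul.injEq] at hb
      obtain ⟨rfl, rfl⟩ := hb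
      subst hs
      cases s with
      | none => simp [preMul, postMul, map_id]
      | some c =>
        have := H a b c
        rw [mul_single_eq_map] at this
        rw [hl]
        exact this
  · rw [hl] at h h'
    -- Mirror image: ⌊c⌋d lies inside the second argument bu of ⌊a⌋(bu) = w.
    obtain ⟨Q, hQ, h₁, h₂⟩ : ∃ Q : OpWord Z → OpWord Z, IsCtx Q ∧ b * u = Q (br c * d) ∧
        ∀ x, v * x = br a * Q x := by
      rcases mul_eq_mul_cases h with ⟨rfl, rfl⟩ | ⟨s, rfl, rfl⟩ | ⟨_, h'', _⟩
      · exact ⟨_, .id, h'.symm, fun x => rfl⟩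
      · exact ⟨_, IsCtx.id.mulLeft s, by rw [h', mul_assoc], fun x => by rw [mul_assoc]⟩
      · exact (mul_ne_br _ _ _ h''.symm).elim
    have h₃ := hR.sub_map_right_mem a c d hQ
    simp only [hl, map_map, ← h₁, ← h₂] at h₃
    rw [← single_mul_eq_map] at h₃
    have h₄ := H a b u
    have hw : br a * (b * u) = v * t * u := by rw [← mul_assoc, h]
    rw [hw] at h₃ h₄
    convert Submodule.sub_mem _ h₃ h₄ using 1
    abel

/-- Relations in `⌊xy⌋` and `xy`. -/
theorem isOperatedGSBasis_br (hR : R.Admissible r) (hlead : R.lead = fun u v => br (u * v))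
    (hpoly : ∀ u v a b, u * v = a * b → R.poly u v = R.poly a b) : IsOperatedGSBasis r R.set := by
  have hl (u v : OpWord Z) : R.lead u v = br (u * v) := by rw [hlead]
  refine hR.isOperatedGSBasis (fun u v a b Q hQ h => ?_) fun a b c d t u v h h' => ?_
  · simp only [hl] at h
    rcases hQ.eq_br h with ⟨rfl, h'⟩ | ⟨F, hF, rfl, hFu⟩
    -- The two words agree, but possibly with different factorizations uv = ab.
    · rw [map_id, hpoly u v a b (br.inj h').symm, sub_self]
      exact zero_mem _
    · rcases hF.eq_mul hFu with ⟨F', hF', rfl, rfl⟩ | ⟨F', hF', rfl, rfl⟩ | ⟨b₁, b₂, p, s, hb, _⟩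
      · simpa only [hl, map_map] using hR.sub_map_left_mem v a b hF'
      · simpa only [hl, map_map] using hR.sub_map_right_mem u a b hF'
      -- A single bracket cannot straddle the cut between u and v; likewise it has no proper
      -- overlaps.
      · exact (mul_ne_br _ _ _ hb.symm).elim
  · rw [hl] at h
    exact (mul_ne_br _ _ _ h.symm).elim

end Admissible

end BiRel

/-! ### The identities -/

section OPI

variable {k : Type*} [Field k] {Z : Type*}

theorem isGS_of_biRel {r : OpWord Z → OpWord Z → Prop} {φ : MonoidAlgebra k (OpWord (Fin 2))}
    (R : BiRel k Z) (hφ : ∀ u : Fin 2 → OpWord Z, substPoly u φ = R.poly (u 0) (u 1))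
    (h : IsOperatedGSBasis r R.set) : IsGS r {φ} := by
  have : instances Z {φ} = R.set := by
    ext f
    constructor
    · rintro ⟨_, rfl, u, rfl⟩
      exact ⟨u 0, u 1, hφ u⟩
    · rintro ⟨u, v, rfl⟩
      exact ⟨φ, rfl, ![u, v], (hφ ![u, v]).symm⟩
  rwa [IsGS, this]

/-- `⌊x⌋⌊y⌋ - l (x⌊y⌋ + ⌊x⌋y) + m ⌊xy⌋ + n xy`. -/
def relN1a (Z : Type*) (l m n : k) : BiRel k Z where
  lead u v := br u * br v
  terms := [(-l, fun u v => u * br v), (-l, fun u v => br u * v), (m, fun u v => br (u * v)),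
    (n, fun u v => u * v)]

/-- `x⌊y⌋ - ⌊xy⌋ + ⌊x⌋y - l xy`. -/
def relN1b (Z : Type*) (l : k) : BiRel k Z where
  lead u v := u * br v
  terms := [(-1, fun u v => br (u * v)), (1, fun u v => br u * v), (-l, fun u v => u * v)]

/-- `⌊xy⌋ - l xy`. -/
def relN1c (Z : Type*) (l : k) : BiRel k Z where
  lead u v := br (u * v)
  terms := [(-l, fun u v => u * v)]

/-- `⌊x⌋⌊y⌋ - l (x⌊y⌋ + ⌊x⌋y) + m ⌊yx⌋ + l² xy - l m yx`. -/
def relN2a (Z : Type*) (l m : k) : BiRel k Z where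
  lead u v := br u * br v
  terms := [(-l, fun u v => u * br v), (-l, fun u v => br u * v), (m, fun u v => br (v * u)),
    (l ^ 2, fun u v => u * v), (-(l * m), fun u v => v * u)]

/-- `x⌊y⌋ - ⌊xy⌋`. -/
def relN3 (k : Type*) [Field k] (Z : Type*) : BiRel k Z where
  lead u v := u * br v
  terms := [(-1, fun u v => br (u * v))]

/-- `⌊x⌋y - ⌊xy⌋`. -/
def relN4 (k : Type*) [Field k] (Z : Type*) : BiRel k Z where
  lead u v := br u * v
  terms := [(-1, fun u v => br (u * v))]

/-! ### Admissibility of the relations. -/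

theorem isCtx_mul_left (c : OpWord Z) : IsCtx fun u => c * u := IsCtx.id.mulLeft c

theorem isCtx_mul_right (c : OpWord Z) : IsCtx fun u => u * c := IsCtx.id.mulRight c

theorem isCtx_br : IsCtx fun u : OpWord Z => br u := IsCtx.id.br

theorem isCtx_mul_br (c : OpWord Z) : IsCtx fun u => c * br u := isCtx_br.mulLeft c

theorem isCtx_br_mul (c : OpWord Z) : IsCtx fun u => br u * c := isCtx_br.mulRight c

theorem isCtx_br_mul_left (c : OpWord Z) : IsCtx fun u => br (c * u) := (isCtx_mul_left c).br

theorem isCtx_br_mul_right (c : OpWord Z) : IsCtx fun u => br (u * c) := (isCtx_mul_right c).br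

variable [LinearOrder Z]

theorem OpWord.DlLT.of_degG_lt {u v : OpWord Z} (hP : u.degP = v.degP) (hX : u.degX = v.degX)
    (h : u.degG < v.degG) : DlLT u v := .inr ⟨hP, .inr ⟨hX, .inl h⟩⟩

theorem OpWord.DlLT'.of_degG'_lt {u v : OpWord Z} (hP : u.degP = v.degP) (hX : u.degX = v.degX)
    (h : u.degG' < v.degG') : DlLT' u v := .inr ⟨hP, .inr ⟨hX, .inl h⟩⟩

/-- From ⌊uv⌋ to u⌊v⌋ the left half bracket moves past the letters of u, raising `degG` by `degX u`
> 0. -/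
theorem br_mul_dlLT_mul_br (u v : OpWord Z) : DlLT (br (u * v)) (u * br v) := by
  refine .of_degG_lt (by simp only [degP_mul, degP]; omega) (by simp) ?_
  simp only [degG_mul, degG_br, degX_mul, degP]
  have := u.degX_pos
  nlinarith

theorem br_mul_dlLT'_br_mul (u v : OpWord Z) : DlLT' (br (u * v)) (br u * v) := by
  refine .of_degG'_lt (by simp only [degP_mul, degP]; omega) (by simp) ?_
  simp only [degG'_mul, degG'_br, degX_mul, degP]
  have := v.degX_pos
  nlinarith

variable [WellFoundedLT Z]

theorem relN1a_admissible (l m n : k) : (relN1a Z l m n).Admissible DbLT where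
  isMonomialOrder := DbLT_isMonomialOrder
  lead_left v := isCtx_br_mul _
  lead_right u := isCtx_mul_br _
  terms_ctx := by
    simp only [relN1a, List.forall_mem_cons, isCtx_br_mul, isCtx_mul_br, isCtx_mul_left,
      isCtx_mul_right, isCtx_br_mul_left, isCtx_br_mul_right, implies_true, true_and,
      List.not_mem_nil, false_implies, and_true]
    refine ⟨?_, ?_, ?_, ?_⟩ <;> exact fun u v => .degP_lt (by simp only [degP_mul, degP]; omega)

theorem relN2a_admissible (l m : k) : (relN2a Z l m).Admissible DbLT where
  isMonomialOrder := DbLT_isMonomialOrder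
  lead_left v := isCtx_br_mul _
  lead_right u := isCtx_mul_br _
  terms_ctx := by
    simp only [relN2a, List.forall_mem_cons, isCtx_br_mul, isCtx_mul_br, isCtx_mul_left,
      isCtx_mul_right, isCtx_br_mul_left, isCtx_br_mul_right, implies_true, true_and,
      List.not_mem_nil, false_implies, and_true]
    refine ⟨?_, ?_, ?_, ?_, ?_⟩ <;> exact fun u v => .degP_lt (by simp only [degP_mul, degP]; omega)

theorem relN1c_admissible (l : k) : (relN1c Z l).Admissible DbLT where
  isMonomialOrder := DbLT_isMonomialOrder
  lead_left v := isCtx_br_mul_right _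
  lead_right u := isCtx_br_mul_left _
  terms_ctx := by
    simp only [relN1c, List.forall_mem_cons, isCtx_mul_left, isCtx_mul_right, implies_true,
      true_and, List.not_mem_nil, false_implies, and_true]
    exact fun u v => .degP_lt (by simp only [degP_mul, degP]; omega)

theorem relN1b_admissible (l : k) : (relN1b Z l).Admissible DlLT where
  isMonomialOrder := DlLT_isMonomialOrder
  lead_left v := isCtx_mul_right _
  lead_right u := isCtx_mul_br _
  terms_ctx := by
    simp only [relN1b, List.forall_mem_cons, isCtx_br_mul, isCtx_mul_left,
      isCtx_mul_right, isCtx_br_mul_left, isCtx_br_mul_right, implies_true, true_and,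
      List.not_mem_nil, false_implies, and_true]
    refine ⟨br_mul_dlLT_mul_br, fun u v => ?_, fun u v => .inl ?_⟩
    · refine .of_degG_lt (by simp only [degP_mul, degP]; omega) (by simp) ?_
      simp only [degG_mul, degG_br, degX_br, degP]
      have := u.degX_pos
      have := v.degX_pos
      nlinarith
    · simp only [degP_mul, degP]
      omega

theorem relN3_admissible : (relN3 k Z).Admissible DlLT where
  isMonomialOrder := DlLT_isMonomialOrder
  lead_left v := isCtx_mul_right _
  lead_right u := isCtx_mul_br _
  terms_ctx := by
    simp only [relN3, List.forall_mem_cons, isCtx_br_mul_left, isCtx_br_mul_right, implies_true,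
      true_and, List.not_mem_nil, false_implies, and_true]
    exact br_mul_dlLT_mul_br

theorem relN4_admissible : (relN4 k Z).Admissible DlLT' where
  isMonomialOrder := DlLT'_isMonomialOrder
  lead_left v := isCtx_br_mul _
  lead_right u := isCtx_mul_left _
  terms_ctx := by
    simp only [relN4, List.forall_mem_cons, isCtx_br_mul_left, isCtx_br_mul_right, implies_true,
      true_and, List.not_mem_nil, false_implies, and_true]
    exact br_mul_dlLT'_br_mul

/-! ### The remaining compositions of each identity. -/

theorem isGS_opiN1a (l m n : k) (h : l ^ 2 = l * m + n) :
    IsGS (DbLT (Z := Z)) {opiN1a l m n} := by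
  refine isGS_of_biRel (relN1a Z l m n) (fun u => ?_)
    ((relN1a_admissible l m n).isOperatedGSBasis_br_mul_br rfl fun a b d => ?_)
  · simp [opiN1a, opiX, opiY, relN1a, BiRel.poly, bracket, substPoly, subst, single_mul_single]
    module
  · have hR := relN1a_admissible (Z := Z) l m n
    have h₁ := hR.map_mem (u := b) (v := d) (w := br a * br b * br d) (isCtx_mul_left a)
      (.degP_lt (by simp only [relN1a, degP_mul, degP]; omega))
    have h₂ := hR.map_mem (u := a) (v := b) (w := br a * br b * br d) (isCtx_mul_right d)
      (.degP_lt (by simp only [relN1a, degP_mul, degP]; omega))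
    have h₃ := hR.map_mem (u := a * b) (v := d) (w := br a * br b * br d) .id
      (.degP_lt (by simp only [relN1a, degP_mul, degP]; omega))
    have h₄ := hR.map_mem (u := a) (v := b * d) (w := br a * br b * br d) .id
      (.degP_lt (by simp only [relN1a, degP_mul, degP]; omega))
    -- With f the relation, f(a,b)⌊d⌋ - ⌊a⌋f(b,d) = -l(a f(b,d) - f(a,b) d) + m(f(ab,d) - f(a,bd)).
    -- The coefficients of ab⌊d⌋ and ⌊a⌋bd match exactly when n = l² - lm.
    convert Submodule.add_mem _ (Submodule.smul_mem _ (-l) (Submodule.sub_mem _ h₁ h₂))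
      (Submodule.smul_mem _ m (Submodule.sub_mem _ h₃ h₄)) using 1
    obtain rfl : n = l ^ 2 - l * m := by rw [h]; ring
    simp only [relN1a, BiRel.poly, List.map_cons, List.map_nil, List.sum_cons, List.sum_nil,
      add_zero, mul_add, add_mul, mul_smul_comm, smul_mul_assoc, single_mul_single, one_mul,
      map_add, map_smul, mapDomainLinearMap_single, mul_assoc]
    module

theorem isGS_opiN2a (l m : k) : IsGS (DbLT (Z := Z)) {opiN2a l m} := by
  refine isGS_of_biRel (relN2a Z l m) (fun u => ?_)
    ((relN2a_admissible l m).isOperatedGSBasis_br_mul_br rfl fun a b d => ?_)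
  · simp [opiN2a, opiX, opiY, relN2a, BiRel.poly, bracket, substPoly, subst, single_mul_single]
    module
  · have hR := relN2a_admissible (Z := Z) l m
    have h₁ := hR.map_mem (u := b) (v := d) (w := br a * br b * br d) (isCtx_mul_left a)
      (.degP_lt (by simp only [relN2a, degP_mul, degP]; omega))
    have h₂ := hR.map_mem (u := a) (v := b) (w := br a * br b * br d) (isCtx_mul_right d)
      (.degP_lt (by simp only [relN2a, degP_mul, degP]; omega))
    have h₃ := hR.map_mem (u := b * a) (v := d) (w := br a * br b * br d) .id
      (.degP_lt (by simp only [relN2a, degP_mul, degP]; omega))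
    have h₄ := hR.map_mem (u := a) (v := d * b) (w := br a * br b * br d) .id
      (.degP_lt (by simp only [relN2a, degP_mul, degP]; omega))
    -- The same combination with f(ba,d) - f(a,db); the coefficients l² and -lm of xy and yx make it
    -- an identity for all l and m.
    convert Submodule.add_mem _ (Submodule.smul_mem _ (-l) (Submodule.sub_mem _ h₁ h₂))
      (Submodule.smul_mem _ m (Submodule.sub_mem _ h₃ h₄)) using 1
    simp only [relN2a, BiRel.poly, List.map_cons, List.map_nil, List.sum_cons, List.sum_nil,
      add_zero, mul_add, add_mul, mul_smul_comm, smul_mul_assoc, single_mul_single, one_mul,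
      map_add, map_smul, mapDomainLinearMap_single, mul_assoc]
    module

/-- The relation f is the Hochschild coboundary of ⌊ ⌋ - l·id, hence a 2-cocycle: f(ca,v) - c f(a,v)
= f(c,av) - f(c,a)v. -/
theorem isGS_opiN1b (l : k) : IsGS (DlLT (Z := Z)) {opiN1b l} := by
  refine isGS_of_biRel (relN1b Z l) (fun u => ?_)
    ((relN1b_admissible l).isOperatedGSBasis_mul_br rfl fun c a v => ?_)
  · simp [opiN1b, opiX, opiY, relN1b, BiRel.poly, bracket, substPoly, subst, single_mul_single]
    module
  · have hR := relN1b_admissible (Z := Z) l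
    have h₁ := hR.map_mem (u := c) (v := a * v) (w := c * a * br v) .id (by
      refine .of_degG_lt ?_ ?_ ?_
      · simp only [relN1b, degP_mul, degP]; omega
      · simp [relN1b]; omega
      · simp only [relN1b, degG_mul, degG_br, degX_mul, degP_mul, degP]
        have := a.degX_pos
        nlinarith)
    have h₂ := hR.map_mem (u := c) (v := a) (w := c * a * br v) (isCtx_mul_right v) (by
      refine .of_degG_lt ?_ ?_ ?_
      · simp only [relN1b, degP_mul, degP]; omega
      · simp [relN1b]
      · simp only [relN1b, degG_mul, degG_br, degX_mul, degX_br, degP]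
        have := a.degX_pos
        nlinarith)
    convert Submodule.sub_mem _ h₁ h₂ using 1
    simp only [relN1b, BiRel.poly, List.map_cons, List.map_nil, List.sum_cons, List.sum_nil,
      add_zero, mul_add, mul_smul_comm, single_mul_single, one_mul,
      map_add, map_smul, mapDomainLinearMap_single, mul_assoc]
    module

theorem isGS_opiN1c (l : k) : IsGS (DbLT (Z := Z)) {opiN1c l} := by
  refine isGS_of_biRel (relN1c Z l) (fun u => ?_)
    ((relN1c_admissible l).isOperatedGSBasis_br rfl fun u v a b h => ?_)
  · simp [opiN1c, opiX, opiY, relN1c, BiRel.poly, bracket, substPoly, subst, single_mul_single]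
    module
  · simp [relN1c, BiRel.poly, h]

/-- Here f(ca,v) - c f(a,v) = c⌊av⌋ - ⌊cav⌋ = f(c,av), and c⌊av⌋ < ca⌊v⌋ by `degG`. -/
theorem isGS_opiN3 : IsGS (DlLT (Z := Z)) {opiN3 (k := k)} := by
  refine isGS_of_biRel (relN3 k Z) (fun u => ?_)
    (relN3_admissible.isOperatedGSBasis_mul_br rfl fun c a v => ?_)
  · simp [opiN3, opiX, opiY, relN3, BiRel.poly, bracket, substPoly, subst, single_mul_single]
    module
  · have h₁ := (relN3_admissible (k := k) (Z := Z)).map_mem (u := c) (v := a * v)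
      (w := c * a * br v) .id (by
      refine .of_degG_lt ?_ ?_ ?_
      · simp only [relN3, degP_mul, degP]; omega
      · simp [relN3]; omega
      · simp only [relN3, degG_mul, degG_br, degX_mul, degP_mul, degP]
        have := a.degX_pos
        nlinarith)
    convert h₁ using 1
    simp only [relN3, BiRel.poly, List.map_cons, List.map_nil, List.sum_cons, List.sum_nil,
      add_zero, mul_add, mul_smul_comm, single_mul_single, one_mul,
      map_add, map_smul, mapDomainLinearMap_single, mul_assoc]
    module

/-- Dually, f(u,ac) - f(u,a)c = f(ua,c), and ⌊ua⌋c < ⌊u⌋ac by `degG'`. -/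
theorem isGS_opiN4 : IsGS (DlLT' (Z := Z)) {opiN4 (k := k)} := by
  refine isGS_of_biRel (relN4 k Z) (fun u => ?_)
    (relN4_admissible.isOperatedGSBasis_br_mul rfl fun u a c => ?_)
  · simp [opiN4, opiX, opiY, relN4, BiRel.poly, bracket, substPoly, subst, single_mul_single]
    module
  · have h₁ := (relN4_admissible (k := k) (Z := Z)).map_mem (u := u * a) (v := c)
      (w := br u * (a * c)) .id (by
      refine .of_degG'_lt ?_ ?_ ?_
      · simp only [relN4, degP_mul, degP]; omega
      · simp [relN4]; omega
      · simp only [relN4, degG'_mul, degG'_br, degX_mul, degP_mul, degP]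
        have := a.degX_pos
        nlinarith)
    convert h₁ using 1
    simp only [relN4, BiRel.poly, List.map_cons, List.map_nil, List.sum_cons, List.sum_nil,
      add_zero, add_mul, smul_mul_assoc, single_mul_single, one_mul,
      map_add, map_smul, mapDomainLinearMap_single, mul_assoc]
    module

end OPI

end OperatedGS

theorem mainTheorem7 (k : Type*) [Field k] (Z : Type*) [LinearOrder Z] [WellFoundedLT Z] :
    (∀ l m n : k, l ^ 2 = l * m + n →
      OperatedGS.IsGS (OperatedGS.OpWord.DbLT (Z := Z)) {OperatedGS.opiN1a l m n}) ∧
    (∀ l : k, OperatedGS.IsGS (OperatedGS.OpWord.DlLT (Z := Z)) {OperatedGS.opiN1b l}) ∧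
    (∀ l : k, OperatedGS.IsGS (OperatedGS.OpWord.DbLT (Z := Z)) {OperatedGS.opiN1c l}) ∧
    (∀ l m : k, OperatedGS.IsGS (OperatedGS.OpWord.DbLT (Z := Z)) {OperatedGS.opiN2a l m}) ∧
    (∀ l : k, OperatedGS.IsGS (OperatedGS.OpWord.DbLT (Z := Z)) {OperatedGS.opiN2b l}) ∧
    OperatedGS.IsGS (OperatedGS.OpWord.DlLT (Z := Z)) {OperatedGS.opiN3 (k := k)} ∧
    OperatedGS.IsGS (OperatedGS.OpWord.DlLT' (Z := Z)) {OperatedGS.opiN4 (k := k)} :=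
  -- `opiN2b` and `opiN1c` unfold to the same element, so one lemma serves both. That the orders are
  -- monomial is part of `IsGS`.
  ⟨OperatedGS.isGS_opiN1a, OperatedGS.isGS_opiN1b, OperatedGS.isGS_opiN1c,
    OperatedGS.isGS_opiN2a, OperatedGS.isGS_opiN1c, OperatedGS.isGS_opiN3, OperatedGS.isGS_opiN4⟩
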